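/- Let $m>0$ and let $x$ be a tortoise coordinate on the exterior Schwarzschild region $r>2m$, i.e. $\frac{dx}{dr}=\left(1-\frac{2m}{r}\right)^{-1}$ for $r>2m$; then $r\mapsto x$ is a bijection from $(2m,\infty)$ onto $\mathbb R$, and we regard $r=r(x)$ as a function of $x\in\mathbb R$. Put $P=\frac{1-2m/r}{r^2}$ and consider the equation $$\partial_t^2W-\partial_x^2W+P\,W(W^2-1)=0,\qquad (t,x)\in\mathbb R\times\mathbb R,$$ which is the spherically symmetric, purely magnetic $SU(2)$ Yang–Mills equation on the exterior of the Schwarzschild black hole of mass $m$. A stationary solution is a solution $W=W(x)$ that does not depend on $t$. There exist a strictly decreasing sequence $(a_n)_{n\ge1}$ of positive real numbers, $$0<\dots<a_n<a_{n-1}<\dots<a_1=\frac{1+\sqrt3}{3\sqrt3+5},$$ and, for every $n\ge1$, a $C^\infty$ stationary solution $W_n:\mathbb R\to\mathbb R$ of this equation such that $$-1\le W_n\le1,\qquad \lim_{x\to-\infty}W_n(x)=a_n,\qquad \lim_{x\to+\infty}W_n(x)=(-1)^n,$$ and $W_n$ has exactly $n$ zeros in $\mathbb R$. -/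

import Mathlib

open Set Filter Topology
open scoped ContDiff

namespace YMSchwarzschild

/-- The function `N = 1 - 2m/r` of the Schwarzschild metric of mass `m`. -/
noncomputable def lapse (m r : ℝ) : ℝ := 1 - 2 * m / r

/-- The potential `P = (1 - 2m/r) / r²`. -/
noncomputable def potential (m r : ℝ) : ℝ := lapse m r / r ^ 2

/-- `xs` is a tortoise coordinate `r ↦ x` on the exterior region `r > 2m`, that is,
`dx/dr = N⁻¹` there. It is determined up to an additive constant. -/
def IsTortoise (m : ℝ) (xs : ℝ → ℝ) : Prop :=
  ∀ r : ℝ, 2 * m < r → HasDerivAt xs (lapse m r)⁻¹ r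

/-- The radius `r > 2m` as a function of the tortoise coordinate `x ∈ ℝ`: the inverse of the
bijection `xs : (2m, ∞) → ℝ` (see `IsTortoise.bijOn`). -/
noncomputable def radius (m : ℝ) (xs : ℝ → ℝ) : ℝ → ℝ :=
  Function.invFunOn xs (Ioi (2 * m))

/-- `u t x` is a classical solution of the reduced Yang-Mills equation
`∂ₜ²u - ∂ₓ²u + P u (u² - 1) = 0` with initial data `(W₀, W₁)` at `t = 0`, where `P` is evaluated
at the radius `r(x)`. -/
structure IsYangMillsSolution (m : ℝ) (xs : ℝ → ℝ) (W₀ W₁ : ℝ → ℝ) (u : ℝ → ℝ → ℝ) : Prop where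
  contDiff : ContDiff ℝ 2 (Function.uncurry u)
  equation : ∀ t x : ℝ,
    iteratedDeriv 2 (fun s => u s x) t - iteratedDeriv 2 (fun y => u t y) x
      + potential m (radius m xs x) * (u t x * ((u t x) ^ 2 - 1)) = 0
  init : ∀ x : ℝ, u 0 x = W₀ x
  init_deriv : ∀ x : ℝ, deriv (fun s => u s x) 0 = W₁ x

/-- `W` is a stationary solution: the time-independent function `(t, x) ↦ W x` solves the reduced
Yang-Mills equation (with initial data `(W, 0)`). -/
def IsStationarySolution (m : ℝ) (xs : ℝ → ℝ) (W : ℝ → ℝ) : Prop :=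
  IsYangMillsSolution m xs W (fun _ => 0) (fun _ x => W x)

/-- The standard tortoise coordinate. -/
theorem isTortoise_standard {m : ℝ} (hm : 0 < m) :
    IsTortoise m (fun r => r + 2 * m * Real.log (r - 2 * m)) := by
  intro r hr
  have h1 : r - 2 * m ≠ 0 := by linarith
  have h2 : r ≠ 0 := by linarith
  have h : HasDerivAt (fun r => r + 2 * m * Real.log (r - 2 * m))
      (1 + 2 * m * (1 / (r - 2 * m))) r :=
    (hasDerivAt_id r).add ((((hasDerivAt_id r).sub_const (2 * m)).log h1).const_mul (2 * m))
  convert h using 1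
  have h3 : lapse m r = (r - 2 * m) / r := by
    unfold lapse; field_simp
  rw [h3]
  field_simp
  ring

/-- A tortoise coordinate is a bijection from `(2m, ∞)` onto `ℝ`. -/
theorem IsTortoise.bijOn {m : ℝ} (hm : 0 < m) {xs : ℝ → ℝ} (h : IsTortoise m xs) :
    BijOn xs (Ioi (2 * m)) univ := by
  have hcont : ContinuousOn xs (Ioi (2 * m)) := fun r hr => (h r hr).continuousAt.continuousWithinAt
  have hmono : StrictMonoOn xs (Ioi (2 * m)) := by
    refine strictMonoOn_of_deriv_pos (convex_Ioi _) hcont fun r hr => ?_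
    rw [interior_Ioi] at hr
    rw [(h r hr).deriv]
    have hr' : 2 * m < r := hr
    have : 2 * m / r < 1 := by rw [div_lt_one (by linarith)]; exact hr'
    exact inv_pos.mpr (by unfold lapse; linarith)
  refine ⟨fun _ _ => mem_univ _, hmono.injOn, fun y _ => ?_⟩
  obtain ⟨c, hc⟩ : ∃ c, ∀ r ∈ Ioi (2 * m), xs r = r + 2 * m * Real.log (r - 2 * m) + c := by
    have key := (isOpen_Ioi (a := 2 * m)).exists_eq_add_of_deriv_eq (𝕜 := ℝ)
      (f := xs) (g := fun r => r + 2 * m * Real.log (r - 2 * m)) isPreconnected_Ioi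
      (fun r hr => (h r hr).differentiableAt.differentiableWithinAt)
      (fun r hr => (isTortoise_standard hm r hr).differentiableAt.differentiableWithinAt)
      (fun r hr => by rw [(h r hr).deriv, (isTortoise_standard hm r hr).deriv])
    obtain ⟨c, hc⟩ := key
    exact ⟨c, fun r hr => hc hr⟩
  set z := y - c with hz
  set K := (2 * m + 1 + |z|) / (2 * m) with hK
  have hK0 : 0 ≤ K := by positivity
  have hmK : 2 * m * K = 2 * m + 1 + |z| := by rw [hK]; field_simp
  have hexp : Real.exp (-K) ≤ 1 := Real.exp_le_one_iff.mpr (by linarith)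
  have hexp0 := Real.exp_pos (-K)
  have hz1 := le_abs_self z
  have hz2 := neg_abs_le z
  have hab : 2 * m + Real.exp (-K) ≤ 2 * m + 1 + |z| := by linarith [abs_nonneg z]
  have hsub : Icc (2 * m + Real.exp (-K)) (2 * m + 1 + |z|) ⊆ Ioi (2 * m) := fun r hr => by
    have := hr.1
    exact lt_of_lt_of_le (by linarith) this
  have hl : xs (2 * m + Real.exp (-K)) ≤ y := by
    rw [hc _ (hsub (left_mem_Icc.mpr hab)), add_sub_cancel_left, Real.log_exp]
    linarith
  have hr : y ≤ xs (2 * m + 1 + |z|) := by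
    rw [hc _ (hsub (right_mem_Icc.mpr hab))]
    have : 0 ≤ Real.log (2 * m + 1 + |z| - 2 * m) :=
      Real.log_nonneg (by linarith [abs_nonneg z])
    have := mul_nonneg (by linarith : (0 : ℝ) ≤ 2 * m) this
    linarith
  obtain ⟨r, hr1, hr2⟩ := intermediate_value_Icc hab (hcont.mono hsub) ⟨hl, hr⟩
  exact ⟨r, hsub hr1, hr2⟩

end YMSchwarzschild

/-!
Measuring lengths in units of the horizon radius, a stationary solution is a function of
`y = x / 2m` with `W'' = P W (W² - 1)`, where `P = (1 - 1/ρ) / ρ²`, `ρ = r / 2m` and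
`ρ' = 1 - 1/ρ`. The proof shoots from the horizon.

* The nonlinearity is set to zero outside `[-1, 1]` (`force`), which makes it globally Lipschitz and
  lets solutions that leave `[-1, 1]` run off along a line, without further zeros
  (`IsSolution.one_lt_of_one_lt`). The integral equation
  `W(x) = a + ∫_{-∞}^x ∫_{-∞}^y P f(W)` is a contraction of ratio `1/2` in the norm with weight
  `ρ⁴`, so for every `a` there is exactly one solution `W_a` with horizon value `a`, and it depends
  continuously on `a` (`IsAreaRadius.exists_isHorizonFamily`).

* Zeros of `W_a` are simple. Hence the number of zeros is lower semicontinuous in `a`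
  (`IsHorizonFamily.eventually_le_encard`), and on every left half-line also upper semicontinuous
  (`IsHorizonFamily.eventually_encard_le`); near a solution that leaves `[-1, 1]` it cannot
  increase.

* If `|W_a| ≤ 1` and `W_a` has finitely many zeros, then `W_a` is eventually concave or convex and
  monotone, and `W_a → ±1`. The energy `ρ² W'² / 2N - (1 - W²)² / 4`, where `N = 1 - 1/ρ`,
  increases for `ρ > 3/2`; a solution that
  comes close to `±1` far out and then returns to `0` reaches `0` with positive energy, after which
  `W' ≠ 0` forever. So there is at most one zero beyond such a point
  (`IsSolution.zeros_subsingleton`), and neighbours of a solution with `n` zeros in `[-1, 1]` have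
  at most `n + 1` zeros (`IsHorizonFamily.eventually_encard_le_succ`).

* For small `a` the equation is close to `W'' + P W = 0`, which oscillates since `P ∼ 1/x²` and
  `1 > 1/4`; so the number of zeros tends to infinity as `a → 0`
  (`IsHorizonFamily.eventually_le_encard_zero`).

Given `a_n`, let `a_{n+1}` be the supremum of the `a < a_n` for which `W_a` has at least `n + 2`
zeros. The semicontinuity properties force `a_{n+1} < a_n`, `|W| ≤ 1` and exactly `n + 1` zeros
(`IsHorizonFamily.exists_isShot_succ`). The induction starts from the explicit solution
`(c - ρ) / (ρ + 3 (c - 1))` with `c = (3 + √3) / 2` (`IsHorizonFamily.isShot_one`).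
-/

namespace YMSchwarzschild

open MeasureTheory

/-! ### The area radius in units of the horizon radius -/

/-- `ρ = r / 2m` as a function of the tortoise coordinate `x / 2m`: in these units
the horizon is `ρ = 1` and the lapse is `1 - ρ⁻¹`. -/
structure IsAreaRadius (ρ : ℝ → ℝ) : Prop where
  one_lt : ∀ x, 1 < ρ x
  hasDerivAt : ∀ x, HasDerivAt ρ (1 - (ρ x)⁻¹) x

/-- The potential `(1 - 1/ρ) / ρ²`, in units of the horizon radius. -/
noncomputable def scaledPotential (ρ : ℝ → ℝ) (x : ℝ) : ℝ := (1 - (ρ x)⁻¹) / ρ x ^ 2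

namespace IsAreaRadius

variable {ρ : ℝ → ℝ} (h : IsAreaRadius ρ)
include h

theorem pos (x : ℝ) : 0 < ρ x := one_pos.trans (h.one_lt x)

theorem lapse_pos (x : ℝ) : 0 < 1 - (ρ x)⁻¹ := sub_pos.2 (inv_lt_one_of_one_lt₀ (h.one_lt x))

theorem lapse_lt_one (x : ℝ) : 1 - (ρ x)⁻¹ < 1 := by
  have := inv_pos.2 (h.pos x)
  linarith

theorem continuous : Continuous ρ :=
  continuous_iff_continuousAt.2 fun x => (h.hasDerivAt x).continuousAt

theorem strictMono : StrictMono ρ :=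
  strictMono_of_hasDerivAt_pos h.hasDerivAt h.lapse_pos

theorem potential_pos (x : ℝ) : 0 < scaledPotential ρ x :=
  div_pos (h.lapse_pos x) (pow_pos (h.pos x) 2)

theorem potential_le_one (x : ℝ) : scaledPotential ρ x ≤ 1 := by
  rw [scaledPotential, div_le_one (pow_pos (h.pos x) 2)]
  have := h.lapse_lt_one x
  have := h.one_lt x
  nlinarith

theorem continuous_potential : Continuous (scaledPotential ρ) := by
  have h0 : ∀ x, ρ x ≠ 0 := fun x => (h.pos x).ne'
  have h1 : ∀ x, ρ x ^ 2 ≠ 0 := fun x => pow_ne_zero _ (h0 x)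
  exact (continuous_const.sub (h.continuous.inv₀ h0)).div (h.continuous.pow 2) h1

theorem hasDerivAt_neg_inv (x : ℝ) :
    HasDerivAt (fun y => -(ρ y)⁻¹) (scaledPotential ρ x) x := by
  refine ((h.hasDerivAt x).inv (h.pos x).ne').neg.congr_deriv ?_
  rw [scaledPotential]
  ring

theorem le_add {x : ℝ} (hx : 0 ≤ x) : ρ x ≤ ρ 0 + x := by
  have hanti : Antitone fun y => ρ y - y :=
    antitone_of_hasDerivAt_nonpos (fun y => (h.hasDerivAt y).sub (hasDerivAt_id y)) fun y => by
      have := h.lapse_lt_one y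
      simp only [Pi.zero_apply]
      linarith
  have := hanti hx
  simp only [sub_zero] at this
  linarith

theorem tendsto_atTop : Tendsto ρ atTop atTop := by
  have hN := h.lapse_pos 0
  have hmono : MonotoneOn (fun y => ρ y - (1 - (ρ 0)⁻¹) * y) (Ici 0) := by
    refine monotoneOn_of_hasDerivWithinAt_nonneg (convex_Ici 0)
      (h.continuous.sub (continuous_const.mul continuous_id)).continuousOn
      (fun y _ => ((h.hasDerivAt y).sub
        ((hasDerivAt_id y).const_mul (1 - (ρ 0)⁻¹))).hasDerivWithinAt) fun y hy => ?_
    rw [interior_Ici] at hy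
    have : (ρ y)⁻¹ ≤ (ρ 0)⁻¹ := inv_anti₀ (h.pos 0) (h.strictMono.monotone (le_of_lt hy))
    linarith
  have hlin : Tendsto (fun y => (1 - (ρ 0)⁻¹) * y) atTop atTop :=
    tendsto_id.const_mul_atTop hN
  refine tendsto_atTop_mono' _ ?_ hlin
  filter_upwards [eventually_ge_atTop 0] with y hy
  have := hmono (mem_Ici.2 le_rfl) (mem_Ici.2 hy) hy
  simp only [mul_zero, sub_zero] at this
  linarith [h.pos 0]

theorem tendsto_atBot : Tendsto ρ atBot (𝓝 1) := by
  set k := (ρ 0)⁻¹ with hk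
  have hk0 : 0 < k := inv_pos.2 (h.pos 0)
  -- `(ρ - 1) e^{-x/ρ(0)}` is monotone on the left half-line, so `ρ - 1` decays exponentially.
  have hmono : MonotoneOn (fun y => (ρ y - 1) * Real.exp (-(k * y))) (Iic 0) := by
    refine monotoneOn_of_hasDerivWithinAt_nonneg (convex_Iic 0)
      (by have := h.continuous; fun_prop)
      (fun y _ => (((h.hasDerivAt y).sub_const 1).mul
        ((hasDerivAt_id y).const_mul k).fun_neg.exp).hasDerivWithinAt) fun y hy => ?_
    rw [interior_Iic] at hy
    have hle : k ≤ (ρ y)⁻¹ := inv_anti₀ (h.pos y) (h.strictMono.monotone (le_of_lt hy))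
    have h1 : 1 - (ρ y)⁻¹ = (ρ y - 1) * (ρ y)⁻¹ := by
      have := (h.pos y).ne'
      field_simp
    have := h.one_lt y
    simp only [id, h1, mul_one]
    have : 0 ≤ (ρ y - 1) * ((ρ y)⁻¹ - k) * Real.exp (-(k * y)) := by
      have := Real.exp_pos (-(k * y))
      have : 0 ≤ (ρ y)⁻¹ - k := by linarith
      have : 0 ≤ ρ y - 1 := by linarith
      positivity
    linarith
  have hup : ∀ y ≤ 0, ρ y ≤ 1 + (ρ 0 - 1) * Real.exp (k * y) := fun y hy => by
    have := hmono (mem_Iic.2 hy) (mem_Iic.2 le_rfl) hy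
    simp only [mul_zero, neg_zero, Real.exp_zero, mul_one] at this
    have he := Real.exp_pos (k * y)
    rw [Real.exp_neg, ← div_eq_mul_inv, div_le_iff₀ he] at this
    linarith
  have hlim : Tendsto (fun y => 1 + (ρ 0 - 1) * Real.exp (k * y)) atBot (𝓝 1) := by
    have : Tendsto (fun y => Real.exp (k * y)) atBot (𝓝 0) :=
      Real.tendsto_exp_atBot.comp (tendsto_id.const_mul_atBot hk0)
    simpa using (this.const_mul (ρ 0 - 1)).const_add 1
  refine tendsto_of_tendsto_of_tendsto_of_le_of_le' tendsto_const_nhds hlim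
    (Eventually.of_forall fun y => (h.one_lt y).le) ?_
  filter_upwards [eventually_le_atBot 0] with y hy using hup y hy

theorem contDiff : ContDiff ℝ ∞ ρ := by
  rw [contDiff_infty]
  intro n
  induction n with
  | zero => exact contDiff_zero.2 h.continuous
  | succ n ih =>
    have hd : deriv ρ = fun x => 1 - (ρ x)⁻¹ := funext fun x => (h.hasDerivAt x).deriv
    have : ((n + 1 : ℕ) : WithTop ℕ∞) = (n : WithTop ℕ∞) + 1 := by norm_cast
    rw [this, contDiff_succ_iff_deriv]
    refine ⟨fun x => (h.hasDerivAt x).differentiableAt, fun hn => by simp at hn, ?_⟩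
    rw [hd]
    exact contDiff_const.sub (ih.inv fun x => (h.pos x).ne')

theorem contDiff_potential : ContDiff ℝ ∞ (scaledPotential ρ) :=
  (contDiff_const.sub (h.contDiff.inv fun x => (h.pos x).ne')).div (h.contDiff.pow 2)
    fun x => pow_ne_zero _ (h.pos x).ne'

theorem exists_eq {c : ℝ} (hc : 1 < c) : ∃ x, ρ x = c := by
  obtain ⟨y, hy⟩ := (h.tendsto_atBot.eventually_lt_const hc).exists
  obtain ⟨z, hz⟩ := (h.tendsto_atTop.eventually_gt_atTop c).exists
  exact mem_range_of_exists_le_of_exists_ge h.continuous ⟨y, hy.le⟩ ⟨z, hz.le⟩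

end IsAreaRadius

/-! ### The truncated nonlinearity -/

/-- The nonlinearity `w (w² - 1)`, replaced by `0` outside `[-1, 1]`. It is globally Lipschitz, and
a solution of the truncated equation that leaves `[-1, 1]` moves on along a straight line. -/
noncomputable def force (w : ℝ) : ℝ := -w * max 0 (1 - w ^ 2)

/-- The primitive `(1 - w²)² / 4` of the truncated nonlinearity, vanishing outside `[-1, 1]`. -/
noncomputable def well (w : ℝ) : ℝ := max 0 (1 - w ^ 2) ^ 2 / 4

theorem force_of_abs_le {w : ℝ} (hw : |w| ≤ 1) : force w = w * (w ^ 2 - 1) := by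
  have : w ^ 2 ≤ 1 := (sq_le_one_iff_abs_le_one w).2 hw
  rw [force, max_eq_right (by linarith)]
  ring

theorem force_of_one_le_abs {w : ℝ} (hw : 1 ≤ |w|) : force w = 0 := by
  have : 1 ≤ w ^ 2 := (one_le_sq_iff_one_le_abs w).2 hw
  rw [force, max_eq_left (by linarith), mul_zero]

theorem force_neg (w : ℝ) : force (-w) = -force w := by simp [force]

theorem force_zero : force 0 = 0 := by simp [force]

theorem force_nonpos {w : ℝ} (hw : 0 ≤ w) : force w ≤ 0 := by
  rw [force, neg_mul, neg_nonpos]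
  positivity

theorem well_nonneg (w : ℝ) : 0 ≤ well w := by
  unfold well
  positivity

theorem continuous_force : Continuous force := by
  unfold force
  fun_prop

theorem abs_force_le (w : ℝ) : |force w| ≤ 1 := by
  rcases le_total |w| 1 with hw | hw
  · rw [force_of_abs_le hw, abs_mul]
    have h1 : w ^ 2 ≤ 1 := (sq_le_one_iff_abs_le_one w).2 hw
    have h2 : |w ^ 2 - 1| ≤ 1 := abs_le.2 ⟨by nlinarith [sq_nonneg w], by linarith⟩
    exact mul_le_one₀ hw (abs_nonneg _) h2
  · simp [force_of_one_le_abs hw]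

theorem abs_force_le_of_one_le {v w : ℝ} (hv : |v| ≤ 1) (hw : 1 ≤ |w|) :
    |force v| ≤ 2 * |v - w| := by
  have h1 : |w| - |v| ≤ |v - w| := by
    have := abs_sub_abs_le_abs_sub w v
    rwa [abs_sub_comm w v] at this
  have h2 : |force v| = |v| * (1 - |v|) * (1 + |v|) := by
    rw [force_of_abs_le hv, abs_mul,
      abs_of_nonpos (sub_nonpos.2 ((sq_le_one_iff_abs_le_one v).2 hv)), ← sq_abs v]
    ring
  rw [h2]
  have h0 := abs_nonneg v
  have h3 : |v| * (1 + |v|) ≤ 2 := by nlinarith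
  nlinarith

theorem abs_force_sub_le (v w : ℝ) : |force v - force w| ≤ 2 * |v - w| := by
  rcases le_total |v| 1 with hv | hv <;> rcases le_total |w| 1 with hw | hw
  · rw [force_of_abs_le hv, force_of_abs_le hw,
      show v * (v ^ 2 - 1) - w * (w ^ 2 - 1) = (v ^ 2 + v * w + w ^ 2 - 1) * (v - w) by ring,
      abs_mul]
    refine mul_le_mul_of_nonneg_right ?_ (abs_nonneg _)
    have h1 : v ^ 2 ≤ 1 := (sq_le_one_iff_abs_le_one v).2 hv
    have h2 : w ^ 2 ≤ 1 := (sq_le_one_iff_abs_le_one w).2 hw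
    exact abs_le.2 ⟨by nlinarith [sq_nonneg (v + w)], by nlinarith [sq_nonneg (v - w)]⟩
  · rw [force_of_one_le_abs hw, sub_zero]
    exact abs_force_le_of_one_le hv hw
  · rw [force_of_one_le_abs hv, zero_sub, abs_neg, abs_sub_comm]
    exact abs_force_le_of_one_le hw hv
  · rw [force_of_one_le_abs hv, force_of_one_le_abs hw]
    simp

theorem hasDerivAt_max_zero_sq (u : ℝ) :
    HasDerivAt (fun y : ℝ => max 0 y ^ 2) (2 * max 0 u) u := by
  rcases lt_trichotomy u 0 with hu | rfl | hu
  · rw [max_eq_left hu.le, mul_zero]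
    refine (hasDerivAt_const u (0 : ℝ)).congr_of_eventuallyEq ?_
    filter_upwards [gt_mem_nhds hu] with y hy
    simp [max_eq_left (le_of_lt hy)]
  · rw [max_self, mul_zero, hasDerivAt_iff_isLittleO]
    have hO : (fun y : ℝ => max 0 y ^ 2) =O[𝓝 0] fun y => y ^ 2 := by
      refine Asymptotics.IsBigO.of_bound 1 (Eventually.of_forall fun y => ?_)
      rw [one_mul, Real.norm_of_nonneg (sq_nonneg _), Real.norm_of_nonneg (sq_nonneg _)]
      rcases le_total 0 y with hy | hy
      · rw [max_eq_right hy]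
      · rw [max_eq_left hy]
        simpa using sq_nonneg y
    have ho : (fun y : ℝ => y ^ 2) =o[𝓝 0] fun y => y := by
      simpa using (Asymptotics.isLittleO_pow_pow (𝕜 := ℝ) (one_lt_two))
    simpa using hO.trans_isLittleO ho
  · rw [max_eq_right hu.le]
    have : HasDerivAt (fun y : ℝ => y ^ 2) (2 * u) u := by simpa using hasDerivAt_pow 2 u
    refine this.congr_of_eventuallyEq ?_
    filter_upwards [lt_mem_nhds hu] with y hy
    rw [max_eq_right (le_of_lt hy)]

theorem hasDerivAt_well (w : ℝ) : HasDerivAt well (force w) w := by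
  have h1 : HasDerivAt (fun y : ℝ => 1 - y ^ 2) (-(2 * w)) w := by
    simpa using (hasDerivAt_pow 2 w).const_sub 1
  refine (((hasDerivAt_max_zero_sq (1 - w ^ 2)).comp w h1).div_const 4).congr_deriv ?_
  rw [force]
  ring

/-! ### Solutions emanating from the horizon -/

/-- A primitive with a limit at `-∞` bounds the integral over `(-∞, x]` of any function dominated by
its derivative. -/
theorem abs_integral_Iic_le {G g u : ℝ → ℝ} {l : ℝ} (hG : ∀ y, HasDerivAt G (g y) y)
    (hgc : Continuous g) (hl : Tendsto G atBot (𝓝 l)) (huc : Continuous u)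
    (hu : ∀ y, |u y| ≤ g y) (x : ℝ) :
    IntegrableOn u (Iic x) ∧ |∫ y in Iic x, u y| ≤ G x - l := by
  have hg0 : ∀ y, 0 ≤ g y := fun y => (abs_nonneg _).trans (hu y)
  have hmono : Monotone G := monotone_of_hasDerivAt_nonneg hG hg0
  have hint : IntegrableOn g (Iic x) := by
    refine integrableOn_Iic_of_intervalIntegral_norm_bounded (G x - l) x (l := atBot) (a := id)
      (fun y => hgc.continuousOn.integrableOn_Icc.mono_set Ioc_subset_Icc_self) tendsto_id
      (Eventually.of_forall fun y => ?_)
    have h1 : ∀ z, ‖g z‖ = g z := fun z => Real.norm_of_nonneg (hg0 z)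
    simp only [h1, id]
    rw [intervalIntegral.integral_eq_sub_of_hasDerivAt (fun z _ => hG z)
      (hgc.intervalIntegrable _ _)]
    have := hmono.le_of_tendsto hl y
    linarith
  have hui : IntegrableOn u (Iic x) := hint.mono' huc.aestronglyMeasurable
    (Eventually.of_forall fun y => hu y)
  refine ⟨hui, ?_⟩
  calc |∫ y in Iic x, u y| ≤ ∫ y in Iic x, |u y| := abs_integral_le_integral_abs
    _ ≤ ∫ y in Iic x, g y := setIntegral_mono hui.abs hint hu
    _ = G x - l := integral_Iic_of_hasDerivAt_of_tendsto' (fun y _ => hG y) hint hl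

theorem hasDerivAt_integral_Iic {u : ℝ → ℝ} (hu : Continuous u)
    (hi : ∀ x, IntegrableOn u (Iic x)) (x : ℝ) :
    HasDerivAt (fun y => ∫ z in Iic y, u z) (u x) x := by
  have h1 : (fun y => ∫ z in Iic y, u z)
      = fun y => (∫ z in (0 : ℝ)..y, u z) + ∫ z in Iic 0, u z := by
    funext y
    rw [← intervalIntegral.integral_Iic_sub_Iic (hi 0) (hi y)]
    ring
  rw [h1]
  exact (intervalIntegral.integral_hasDerivAt_right (hu.intervalIntegrable _ _)
    (hu.stronglyMeasurableAtFilter _ _) hu.continuousAt).add_const _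

/-- `(W, V)` is a solution of `W' = V`, `V' = P f(W)`, where `f` is the truncated nonlinearity. -/
structure IsSolution (ρ W V : ℝ → ℝ) : Prop where
  deriv_fst : ∀ x, HasDerivAt W (V x) x
  deriv_snd : ∀ x, HasDerivAt V (scaledPotential ρ x * force (W x)) x

/-- The first integral `∫_{-∞}^y P f(W)` of the equation: the slope of the solution. -/
noncomputable def slopeIntegral (ρ W : ℝ → ℝ) (y : ℝ) : ℝ :=
  ∫ z in Iic y, scaledPotential ρ z * force (W z)

/-- The second integral `∫_{-∞}^x ∫_{-∞}^y P f(W)` of the equation. -/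
noncomputable def valueIntegral (ρ W : ℝ → ℝ) (x : ℝ) : ℝ := ∫ y in Iic x, slopeIntegral ρ W y

namespace IsAreaRadius

variable {ρ : ℝ → ℝ} (h : IsAreaRadius ρ)
include h

theorem tendsto_neg_inv_atBot : Tendsto (fun y => -(ρ y)⁻¹) atBot (𝓝 (-1)) := by
  simpa using (h.tendsto_atBot.inv₀ one_ne_zero).neg

theorem continuous_lapse : Continuous fun y => 1 - (ρ y)⁻¹ :=
  continuous_const.sub (h.continuous.inv₀ fun x => (h.pos x).ne')

theorem abs_potential_mul_force_le (y w : ℝ) :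
    |scaledPotential ρ y * force w| ≤ scaledPotential ρ y := by
  rw [abs_mul, abs_of_pos (h.potential_pos y)]
  exact mul_le_of_le_one_right (h.potential_pos y).le (abs_force_le _)

section

variable {W : ℝ → ℝ} (hW : Continuous W)
include hW

theorem continuous_potential_mul_force :
    Continuous fun y => scaledPotential ρ y * force (W y) :=
  h.continuous_potential.mul (continuous_force.comp hW)

theorem integrableOn_potential_mul_force (x : ℝ) :
    IntegrableOn (fun y => scaledPotential ρ y * force (W y)) (Iic x) :=
  (abs_integral_Iic_le h.hasDerivAt_neg_inv h.continuous_potential h.tendsto_neg_inv_atBot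
    (h.continuous_potential_mul_force hW) (fun y => h.abs_potential_mul_force_le y _) x).1

theorem abs_slopeIntegral_le (x : ℝ) : |slopeIntegral ρ W x| ≤ 1 - (ρ x)⁻¹ := by
  have := (abs_integral_Iic_le h.hasDerivAt_neg_inv h.continuous_potential h.tendsto_neg_inv_atBot
    (h.continuous_potential_mul_force hW) (fun y => h.abs_potential_mul_force_le y _) x).2
  rw [slopeIntegral]
  linarith

theorem hasDerivAt_slopeIntegral (x : ℝ) :
    HasDerivAt (slopeIntegral ρ W) (scaledPotential ρ x * force (W x)) x :=
  hasDerivAt_integral_Iic (h.continuous_potential_mul_force hW)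
    (h.integrableOn_potential_mul_force hW) x

theorem continuous_slopeIntegral : Continuous (slopeIntegral ρ W) :=
  continuous_iff_continuousAt.2 fun x => (h.hasDerivAt_slopeIntegral hW x).continuousAt

theorem integrableOn_slopeIntegral (x : ℝ) : IntegrableOn (slopeIntegral ρ W) (Iic x) :=
  (abs_integral_Iic_le h.hasDerivAt h.continuous_lapse h.tendsto_atBot
    (h.continuous_slopeIntegral hW) (h.abs_slopeIntegral_le hW) x).1

theorem abs_valueIntegral_le (x : ℝ) : |valueIntegral ρ W x| ≤ ρ x - 1 :=
  (abs_integral_Iic_le h.hasDerivAt h.continuous_lapse h.tendsto_atBot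
    (h.continuous_slopeIntegral hW) (h.abs_slopeIntegral_le hW) x).2

theorem hasDerivAt_valueIntegral (x : ℝ) :
    HasDerivAt (valueIntegral ρ W) (slopeIntegral ρ W x) x :=
  hasDerivAt_integral_Iic (h.continuous_slopeIntegral hW) (h.integrableOn_slopeIntegral hW) x

theorem continuous_valueIntegral : Continuous (valueIntegral ρ W) :=
  continuous_iff_continuousAt.2 fun x => (h.hasDerivAt_valueIntegral hW x).continuousAt

end

section

variable {W₁ W₂ : ℝ → ℝ} (hW₁ : Continuous W₁) (hW₂ : Continuous W₂) {d : ℝ}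
  (hd : ∀ x, |W₁ x - W₂ x| ≤ d * ρ x ^ 4)
include hW₁ hW₂ hd

theorem abs_slopeIntegral_sub_le (x : ℝ) :
    |slopeIntegral ρ W₁ x - slopeIntegral ρ W₂ x| ≤ 2 * d / 3 * (ρ x ^ 3 - 1) := by
  have hG : ∀ y, HasDerivAt (fun y => 2 * d / 3 * ρ y ^ 3)
      (scaledPotential ρ y * (2 * (d * ρ y ^ 4))) y := fun y => by
    refine (((h.hasDerivAt y).pow 3).const_mul (2 * d / 3)).congr_deriv ?_
    have := (h.pos y).ne'
    rw [scaledPotential]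
    field_simp
    norm_num
  have hl : Tendsto (fun y => 2 * d / 3 * ρ y ^ 3) atBot (𝓝 (2 * d / 3)) := by
    simpa using (h.tendsto_atBot.pow 3).const_mul (2 * d / 3)
  have key := (abs_integral_Iic_le hG
    (h.continuous_potential.mul (continuous_const.mul (continuous_const.mul (h.continuous.pow 4))))
    hl ((h.continuous_potential_mul_force hW₁).fun_sub (h.continuous_potential_mul_force hW₂))
    (fun y => by
      rw [← mul_sub, abs_mul, abs_of_pos (h.potential_pos y)]
      refine mul_le_mul_of_nonneg_left ?_ (h.potential_pos y).le
      exact (abs_force_sub_le _ _).trans (mul_le_mul_of_nonneg_left (hd y) two_pos.le)) x).2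
  rw [integral_sub (h.integrableOn_potential_mul_force hW₁ x)
    (h.integrableOn_potential_mul_force hW₂ x)] at key
  rw [slopeIntegral, slopeIntegral]
  linarith

theorem abs_valueIntegral_sub_le (x : ℝ) :
    |valueIntegral ρ W₁ x - valueIntegral ρ W₂ x| ≤ d / 2 * ρ x ^ 4 := by
  have hd0 : 0 ≤ d := by
    have h1 := (abs_nonneg _).trans (hd 0)
    exact nonneg_of_mul_nonneg_left h1 (pow_pos (h.pos 0) 4)
  have hG : ∀ y, HasDerivAt (fun y => d / 2 * ρ y ^ 4)
      (2 * d * ρ y ^ 3 * (1 - (ρ y)⁻¹)) y := fun y => by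
    refine (((h.hasDerivAt y).pow 4).const_mul (d / 2)).congr_deriv ?_
    norm_num
    ring
  have hl : Tendsto (fun y => d / 2 * ρ y ^ 4) atBot (𝓝 (d / 2)) := by
    simpa using (h.tendsto_atBot.pow 4).const_mul (d / 2)
  have key := (abs_integral_Iic_le hG
    ((continuous_const.mul (h.continuous.pow 3)).mul h.continuous_lapse) hl
    ((h.continuous_slopeIntegral hW₁).fun_sub (h.continuous_slopeIntegral hW₂))
    (fun y => by
      refine (h.abs_slopeIntegral_sub_le hW₁ hW₂ hd y).trans ?_
      have h1 := h.one_lt y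
      have h2 : ρ y ^ 3 * (1 - (ρ y)⁻¹) = ρ y ^ 3 - ρ y ^ 2 := by
        have := (h.pos y).ne'
        field_simp
      rw [mul_assoc (2 * d), h2]
      have h3 : ρ y ^ 3 - 1 ≤ 3 * (ρ y ^ 3 - ρ y ^ 2) := by
        nlinarith [mul_pos (sub_pos.2 h1) (sub_pos.2 h1), sq_nonneg (ρ y)]
      nlinarith) x).2
  rw [integral_sub (h.integrableOn_slopeIntegral hW₁ x) (h.integrableOn_slopeIntegral hW₂ x)] at key
  rw [valueIntegral, valueIntegral]
  linarith

end

/-- Two solutions of the integral equation are as close, in the norm with weight `ρ⁴`, as twice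
the difference of their values at the horizon. -/
theorem abs_sub_le_of_integral_eq {W₁ W₂ : ℝ → ℝ} {a b : ℝ} (hW₁ : Continuous W₁)
    (hW₂ : Continuous W₂) (h₁ : ∀ x, W₁ x = a + valueIntegral ρ W₁ x)
    (h₂ : ∀ x, W₂ x = b + valueIntegral ρ W₂ x) (x : ℝ) :
    |W₁ x - W₂ x| ≤ 2 * |a - b| * ρ x ^ 4 := by
  have hρ4 : ∀ y, 1 ≤ ρ y ^ 4 := fun y => one_le_pow₀ (h.one_lt y).le
  have hbdd : BddAbove (range fun y => |W₁ y - W₂ y| / ρ y ^ 4) := by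
    refine ⟨|a - b| + 2, ?_⟩
    rintro _ ⟨y, rfl⟩
    have h4 := hρ4 y
    have h5 : ρ y ≤ ρ y ^ 4 := le_self_pow₀ (h.one_lt y).le (by norm_num)
    have h6 := h.abs_valueIntegral_le hW₁ y
    have h7 := h.abs_valueIntegral_le hW₂ y
    change |W₁ y - W₂ y| / ρ y ^ 4 ≤ _
    rw [div_le_iff₀ (by linarith)]
    calc |W₁ y - W₂ y| = |(a - b) + (valueIntegral ρ W₁ y - valueIntegral ρ W₂ y)| := by
          rw [h₁, h₂]; congr 1; ring
      _ ≤ |a - b| + (|valueIntegral ρ W₁ y| + |valueIntegral ρ W₂ y|) :=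
          (abs_add_le _ _).trans (add_le_add_right (abs_sub _ _) _)
      _ ≤ (|a - b| + 2) * ρ y ^ 4 := by nlinarith [abs_nonneg (a - b)]
  set d := ⨆ y, |W₁ y - W₂ y| / ρ y ^ 4 with hd_def
  have hd : ∀ y, |W₁ y - W₂ y| ≤ d * ρ y ^ 4 := fun y => by
    rw [← div_le_iff₀ (by linarith [hρ4 y])]
    exact le_ciSup hbdd y
  have hd' : d ≤ |a - b| + d / 2 := by
    refine ciSup_le fun y => ?_
    have h4 := hρ4 y
    rw [div_le_iff₀ (by linarith)]
    have h5 := h.abs_valueIntegral_sub_le hW₁ hW₂ hd y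
    calc |W₁ y - W₂ y| = |(a - b) + (valueIntegral ρ W₁ y - valueIntegral ρ W₂ y)| := by
          rw [h₁, h₂]; congr 1; ring
      _ ≤ |a - b| + |valueIntegral ρ W₁ y - valueIntegral ρ W₂ y| := abs_add_le _ _
      _ ≤ (|a - b| + d / 2) * ρ y ^ 4 := by nlinarith [abs_nonneg (a - b)]
  exact (hd x).trans (mul_le_mul_of_nonneg_right (by linarith) (by linarith [hρ4 x]))

/-- The integral equation is solved by the contraction principle for `W / ρ⁴`. -/
theorem exists_integral_eq (a : ℝ) :
    ∃ W : ℝ → ℝ, Continuous W ∧ ∀ x, W x = a + valueIntegral ρ W x := by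
  have hρ4 : ∀ y, 1 ≤ ρ y ^ 4 := fun y => one_le_pow₀ (h.one_lt y).le
  have hc : ∀ w : BoundedContinuousFunction ℝ ℝ, Continuous fun y => ρ y ^ 4 * w y :=
    fun w => (h.continuous.pow 4).mul w.continuous
  let T : BoundedContinuousFunction ℝ ℝ → BoundedContinuousFunction ℝ ℝ := fun w =>
    BoundedContinuousFunction.ofNormedAddCommGroup
      (fun x => (a + valueIntegral ρ (fun y => ρ y ^ 4 * w y) x) / ρ x ^ 4)
      ((continuous_const.add (h.continuous_valueIntegral (hc w))).div (h.continuous.pow 4)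
        fun x => pow_ne_zero _ (h.pos x).ne') (|a| + 1) fun x => by
          have h4 := hρ4 x
          have h5 : ρ x ≤ ρ x ^ 4 := le_self_pow₀ (h.one_lt x).le (by norm_num)
          rw [Real.norm_eq_abs, abs_div, abs_of_pos (by linarith : 0 < ρ x ^ 4),
            div_le_iff₀ (by linarith)]
          have h6 := h.abs_valueIntegral_le (hc w) x
          refine (abs_add_le _ _).trans ?_
          nlinarith [abs_nonneg a]
  have hT : ∀ w x, T w x = (a + valueIntegral ρ (fun y => ρ y ^ 4 * w y) x) / ρ x ^ 4 :=
    fun w x => rfl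
  have hcontr : ContractingWith (1 / 2) T := by
    refine ⟨by rw [← NNReal.coe_lt_coe]; norm_num, LipschitzWith.of_dist_le_mul fun w₁ w₂ => ?_⟩
    rw [BoundedContinuousFunction.dist_le (by positivity)]
    intro x
    have h4 := hρ4 x
    have key := h.abs_valueIntegral_sub_le (hc w₁) (hc w₂) (d := dist w₁ w₂) (fun y => by
      rw [← mul_sub, abs_mul, abs_of_pos (by linarith [hρ4 y] : 0 < ρ y ^ 4), mul_comm]
      refine mul_le_mul_of_nonneg_right ?_ (by linarith [hρ4 y])
      rw [← Real.dist_eq]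
      exact BoundedContinuousFunction.dist_coe_le_dist y) x
    rw [Real.dist_eq, hT, hT, ← sub_div, abs_div, abs_of_pos (by linarith : 0 < ρ x ^ 4),
      div_le_iff₀ (by linarith), add_sub_add_left_eq_sub]
    refine key.trans (le_of_eq ?_)
    push_cast
    ring
  refine ⟨fun y => ρ y ^ 4 * ContractingWith.fixedPoint T hcontr y, hc _, fun x => ?_⟩
  have hfix := hcontr.fixedPoint_isFixedPt
  have h1 := hT (ContractingWith.fixedPoint T hcontr) x
  rw [hfix.eq] at h1
  have h4 := hρ4 x
  rw [eq_div_iff (by positivity)] at h1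
  linarith

end IsAreaRadius

/-- `W a` is the solution with horizon value `a`, and `V a` its slope, for every `a`. The bounds
make `W` and `V` jointly continuous. -/
structure IsHorizonFamily (ρ : ℝ → ℝ) (W V : ℝ → ℝ → ℝ) : Prop where
  isSolution : ∀ a, IsSolution ρ (W a) (V a)
  abs_sub_le : ∀ a x, |W a x - a| ≤ ρ x - 1
  lipschitz_fst : ∀ a b x, |W a x - W b x| ≤ 2 * |a - b| * ρ x ^ 4
  lipschitz_snd : ∀ a b x, |V a x - V b x| ≤ 2 * |a - b| * ρ x ^ 4
  unique : ∀ a w v, IsSolution ρ w v → Tendsto w atBot (𝓝 a) → Tendsto v atBot (𝓝 0) → w = W a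

theorem IsAreaRadius.exists_isHorizonFamily {ρ : ℝ → ℝ} (h : IsAreaRadius ρ) :
    ∃ W V : ℝ → ℝ → ℝ, IsHorizonFamily ρ W V := by
  choose W hWc hW using h.exists_integral_eq
  have hWf : ∀ a, W a = fun x => a + valueIntegral ρ (W a) x := fun a => funext (hW a)
  have hlip : ∀ a b x, |W a x - W b x| ≤ 2 * |a - b| * ρ x ^ 4 := fun a b x =>
    h.abs_sub_le_of_integral_eq (hWc a) (hWc b) (hW a) (hW b) x
  refine ⟨W, fun a => slopeIntegral ρ (W a), fun a => ⟨fun x => ?_, fun x => ?_⟩, fun a x => ?_,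
    hlip, fun a b x => ?_, fun a w v hs hw hv => ?_⟩
  · have h1 := (h.hasDerivAt_valueIntegral (hWc a) x).const_add a
    rwa [← hWf a] at h1
  · exact h.hasDerivAt_slopeIntegral (hWc a) x
  · rw [hW a x, add_sub_cancel_left]
    exact h.abs_valueIntegral_le (hWc a) x
  · have h1 := h.abs_slopeIntegral_sub_le (hWc a) (hWc b) (hlip a b) x
    have h2 : ρ x ^ 3 ≤ ρ x ^ 4 := pow_le_pow_right₀ (h.one_lt x).le (by norm_num)
    have h3 : 1 ≤ ρ x ^ 3 := one_le_pow₀ (h.one_lt x).le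
    nlinarith [abs_nonneg (a - b)]
  · have hwc : Continuous w :=
      continuous_iff_continuousAt.2 fun x => (hs.deriv_fst x).continuousAt
    have hv' : ∀ x, v x = slopeIntegral ρ w x := fun x => by
      rw [slopeIntegral, integral_Iic_of_hasDerivAt_of_tendsto' (fun y _ => hs.deriv_snd y)
        (h.integrableOn_potential_mul_force hwc x) hv, sub_zero]
    have hw' : ∀ x, w x = a + valueIntegral ρ w x := fun x => by
      rw [valueIntegral, integral_Iic_of_hasDerivAt_of_tendsto'
        (fun y _ => (hv' y) ▸ hs.deriv_fst y) (h.integrableOn_slopeIntegral hwc x) hw]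
      ring
    funext x
    have := h.abs_sub_le_of_integral_eq hwc (hWc a) hw' (hW a) x
    rw [sub_self, abs_zero, mul_zero, zero_mul] at this
    exact sub_eq_zero.1 (abs_nonpos_iff.1 this)

/-! ### Dynamics of a single solution -/

/-- The energy `ρ² W'² / 2N - (1 - W²)² / 4`, with `N = 1 - 1/ρ` the lapse; it is nondecreasing
outside the photon sphere `ρ = 3/2`. -/
noncomputable def energy (ρ W V : ℝ → ℝ) (x : ℝ) : ℝ :=
  ρ x ^ 3 * V x ^ 2 / (2 * (ρ x - 1)) - well (W x)

theorem IsAreaRadius.neg_well_le_energy {ρ : ℝ → ℝ} (h : IsAreaRadius ρ) (W V : ℝ → ℝ) (x : ℝ) :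
    -well (W x) ≤ energy ρ W V x := by
  have h2 : 0 < 2 * (ρ x - 1) := by have := h.one_lt x; linarith
  have h4 := h.pos x
  have : 0 ≤ ρ x ^ 3 * V x ^ 2 / (2 * (ρ x - 1)) := by positivity
  rw [energy]
  linarith

/-- Near a simple zero `z` a function has the sign of its linearization. -/
theorem exists_pos_mul_of_hasDerivAt {f : ℝ → ℝ} {c z : ℝ} (hf : HasDerivAt f c z) (hz : f z = 0)
    (hc : c ≠ 0) : ∃ ε > 0, ∀ y, y ≠ z → |y - z| < ε → 0 < c * f y * (y - z) := by
  have h1 := (hasDerivAt_iff_tendsto_slope.1 hf).const_mul c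
  have h2 : ∀ᶠ y in 𝓝[≠] z, 0 < c * slope f z y :=
    h1.eventually_const_lt (mul_self_pos.2 hc)
  rw [eventually_nhdsWithin_iff, Metric.eventually_nhds_iff] at h2
  obtain ⟨ε, hε, h3⟩ := h2
  refine ⟨ε, hε, fun y hy hyz => ?_⟩
  have h4 := h3 (by rwa [Real.dist_eq]) hy
  have h5 : y - z ≠ 0 := sub_ne_zero.2 hy
  rw [slope_def_field, hz, sub_zero] at h4
  have h6 := mul_pos h4 (pow_pos (abs_pos.2 h5) 2)
  rw [sq_abs] at h6
  have h7 : c * f y * (y - z) = c * (f y / (y - z)) * (y - z) ^ 2 := by field_simp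
  rwa [h7]

namespace IsSolution

variable {ρ W V : ℝ → ℝ} (hs : IsSolution ρ W V)

theorem const {w : ℝ} (hw : force w = 0) : IsSolution ρ (fun _ => w) (fun _ => 0) :=
  ⟨fun x => hasDerivAt_const x w, fun x => by rw [hw, mul_zero]; exact hasDerivAt_const x _⟩

include hs

theorem neg : IsSolution ρ (fun x => -W x) (fun x => -V x) :=
  ⟨fun x => (hs.deriv_fst x).neg, fun x => by
    rw [force_neg, mul_neg]
    exact (hs.deriv_snd x).neg⟩

theorem continuous_fst : Continuous W :=
  continuous_iff_continuousAt.2 fun x => (hs.deriv_fst x).continuousAt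

theorem continuous_snd : Continuous V :=
  continuous_iff_continuousAt.2 fun x => (hs.deriv_snd x).continuousAt

variable (h : IsAreaRadius ρ)
include h

/-- Two solutions with the same data at one point agree. -/
theorem eq_of_eq_at {W' V' : ℝ → ℝ} (hs' : IsSolution ρ W' V') {p : ℝ} (hW : W p = W' p)
    (hV : V p = V' p) : W = W' := by
  have hlip : ∀ t : ℝ, LipschitzOnWith 2
      (fun q : ℝ × ℝ => (q.2, scaledPotential ρ t * force q.1)) univ := fun t => by
    refine LipschitzOnWith.of_dist_le_mul fun q _ q' _ => ?_
    rw [Prod.dist_eq, Prod.dist_eq]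
    have h1 := abs_force_sub_le q.1 q'.1
    have h2 := h.potential_le_one t
    have h3 := h.potential_pos t
    simp only [Real.dist_eq, NNReal.coe_ofNat]
    refine max_le ?_ ?_
    · have := le_max_right |q.1 - q'.1| |q.2 - q'.2|
      have := abs_nonneg (q.2 - q'.2)
      linarith
    · have := le_max_left |q.1 - q'.1| |q.2 - q'.2|
      rw [← mul_sub, abs_mul, abs_of_pos h3]
      have h4 := abs_nonneg (force q.1 - force q'.1)
      nlinarith
  have key := ODE_solution_unique_univ (t₀ := p) (f := fun t => (W t, V t))
    (g := fun t => (W' t, V' t)) hlip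
    (fun t => ⟨(hs.deriv_fst t).prodMk (hs.deriv_snd t), mem_univ _⟩)
    (fun t => ⟨(hs'.deriv_fst t).prodMk (hs'.deriv_snd t), mem_univ _⟩)
    (Prod.ext hW hV)
  funext t
  exact congrArg Prod.fst (congrFun key t)

theorem eq_const {p : ℝ} (hV : V p = 0) (hW : force (W p) = 0) (x : ℝ) : W x = W p :=
  congrFun (hs.eq_of_eq_at h (const hW) (p := p) rfl hV) x

/-- A solution that rises above `1` at `x` stays there: otherwise it would have a maximum above
`1`, hence be one of the constant solutions of the truncated equation. -/
theorem one_lt_of_one_lt {x₁ x y : ℝ} (h₁ : W x₁ ≤ 1) (hx₁ : x₁ ≤ x) (hx : 1 < W x)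
    (hxy : x ≤ y) : 1 < W y := by
  by_contra! hy
  obtain ⟨p, hp, hmax⟩ := (isCompact_Icc (a := x₁) (b := y)).exists_isMaxOn
    ⟨x₁, left_mem_Icc.2 (hx₁.trans hxy)⟩ hs.continuous_fst.continuousOn
  have hWp : 1 < W p := hx.trans_le (hmax ⟨hx₁, hxy⟩)
  have hp1 : x₁ < p := lt_of_le_of_ne hp.1 fun e => by rw [e] at h₁; linarith
  have hp2 : p < y := lt_of_le_of_ne hp.2 fun e => by rw [← e] at hy; linarith
  have hVp : V p = 0 := (hmax.isLocalMax (Icc_mem_nhds hp1 hp2)).hasDerivAt_eq_zero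
    (hs.deriv_fst p)
  have := hs.eq_const h hVp (force_of_one_le_abs (hWp.le.trans (le_abs_self _))) x₁
  linarith

theorem hasDerivAt_energy (x : ℝ) :
    HasDerivAt (energy ρ W V) (ρ x * (2 * ρ x - 3) * V x ^ 2 / (2 * (ρ x - 1))) x := by
  have h1 : 2 * (ρ x - 1) ≠ 0 := by have := h.one_lt x; linarith
  have h2 : ρ x - 1 ≠ 0 := by have := h.one_lt x; linarith
  have h3 := (h.pos x).ne'
  refine (((((h.hasDerivAt x).fun_pow 3).fun_mul ((hs.deriv_snd x).fun_pow 2)).fun_div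
    (((h.hasDerivAt x).sub_const 1).const_mul 2) h1).fun_sub
    ((hasDerivAt_well (W x)).comp x (hs.deriv_fst x))).congr_deriv ?_
  rw [scaledPotential]
  field_simp
  push_cast
  ring

theorem energy_monotoneOn {X : ℝ} (hX : 3 ≤ ρ X) : MonotoneOn (energy ρ W V) (Ici X) := by
  refine monotoneOn_of_hasDerivWithinAt_nonneg (convex_Ici X)
    (fun x _ => (hs.hasDerivAt_energy h x).continuousAt.continuousWithinAt)
    (fun x _ => (hs.hasDerivAt_energy h x).hasDerivWithinAt) fun x hx => ?_
  rw [interior_Ici] at hx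
  have h1 := h.strictMono hx
  have h2 : 0 ≤ 2 * ρ x - 3 := by linarith
  have h3 : 0 ≤ 2 * (ρ x - 1) := by linarith
  have h4 := h.pos x
  positivity

/-- The first zero after a far point at which the solution is close to `1` is reached with
positive energy, since the energy grows by a definite amount while `W` falls from `1/2` to `0`. -/
theorem energy_pos_of_first_zero {X y : ℝ} (hX : 3 ≤ ρ X) (hWX : 9 / 10 ≤ W X) (hXy : X ≤ y)
    (hy : W y = 0) (hpos : ∀ x ∈ Ico X y, W x ≠ 0) : 0 < energy ρ W V y := by
  have hcont := hs.continuous_fst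
  have hE := hs.energy_monotoneOn h hX
  have hEX : -(1 / 64) ≤ energy ρ W V X := by
    refine le_trans ?_ (h.neg_well_le_energy W V X)
    have h1 : max 0 (1 - W X ^ 2) ≤ 19 / 100 := max_le (by norm_num) (by nlinarith)
    have h2 : 0 ≤ max 0 (1 - W X ^ 2) := le_max_left _ _
    rw [well]
    nlinarith
  have hpos' : ∀ x ∈ Ico X y, 0 < W x := fun x hx => by
    by_contra! hneg
    obtain ⟨z, hz, hz0⟩ := intermediate_value_Icc' hx.1 hcont.continuousOn
      ⟨hneg, by linarith⟩
    exact hpos z ⟨hz.1, hz.2.trans_lt hx.2⟩ hz0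
  obtain ⟨p, ⟨hp, hpW⟩, hpmax⟩ := (isCompact_Icc (a := X) (b := y)).inter_right
    (isClosed_le continuous_const hcont) |>.exists_isGreatest
    (s := Icc X y ∩ {x | 1 / 2 ≤ W x}) ⟨X, left_mem_Icc.2 hXy, by
      change 1 / 2 ≤ W X
      linarith⟩
  change 1 / 2 ≤ W p at hpW
  have hmono : MonotoneOn (fun x => energy ρ W V x + 1 / 4 * W x) (Icc p y) := by
    have hd : ∀ x, HasDerivAt (fun x => energy ρ W V x + 1 / 4 * W x)
        (ρ x * (2 * ρ x - 3) * V x ^ 2 / (2 * (ρ x - 1)) + 1 / 4 * V x) x := fun x =>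
      (hs.hasDerivAt_energy h x).fun_add ((hs.deriv_fst x).const_mul (1 / 4))
    refine monotoneOn_of_hasDerivWithinAt_nonneg (convex_Icc p y)
      (fun x _ => (hd x).continuousAt.continuousWithinAt)
      (fun x _ => (hd x).hasDerivWithinAt) fun x hx => ?_
    rw [interior_Icc] at hx
    have hXx : X ≤ x := hp.1.trans hx.1.le
    have hx0 := hpos' x ⟨hXx, hx.2⟩
    have hx1 : W x < 1 / 2 := by
      by_contra! hge
      exact absurd (hpmax ⟨⟨hXx, hx.2.le⟩, hge⟩) (not_le.2 hx.1)
    have hwell : 9 / 64 ≤ well (W x) := by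
      have : 3 / 4 ≤ max 0 (1 - W x ^ 2) := le_max_of_le_right (by nlinarith)
      rw [well]
      nlinarith
    have hEx : -(1 / 64) ≤ energy ρ W V x := hEX.trans (hE (mem_Ici.2 le_rfl) hXx hXx)
    have hρ : 3 ≤ ρ x := hX.trans (h.strictMono.monotone hXx)
    -- The kinetic term is at least `1/8`, so `ρ |V|` is at least half the lapse.
    have hkin : 1 / 8 ≤ ρ x ^ 3 * V x ^ 2 / (2 * (ρ x - 1)) := by
      rw [energy] at hEx
      linarith
    rw [le_div_iff₀ (by linarith)] at hkin
    have hV : (ρ x - 1) ≤ 2 * ρ x ^ 2 * |V x| := by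
      by_contra! hlt
      have h1 : (2 * ρ x ^ 2 * |V x|) ^ 2 < (ρ x - 1) ^ 2 :=
        pow_lt_pow_left₀ hlt (by positivity) two_ne_zero
      have h2 : (2 * ρ x ^ 2 * |V x|) ^ 2 = 4 * ρ x * (ρ x ^ 3 * V x ^ 2) := by
        rw [mul_pow, sq_abs]; ring
      rw [h2] at h1
      nlinarith
    have hnum : (ρ x - 1) * |V x| ≤ 2 * (ρ x * (2 * ρ x - 3) * V x ^ 2) := by
      have h1 : ρ x * ρ x * V x ^ 2 ≤ ρ x * (2 * ρ x - 3) * V x ^ 2 := by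
        refine mul_le_mul_of_nonneg_right ?_ (sq_nonneg _)
        nlinarith
      have h2 := mul_le_mul_of_nonneg_right hV (abs_nonneg (V x))
      rw [mul_assoc (2 * ρ x ^ 2), ← pow_two |V x|, sq_abs] at h2
      linarith
    have h3 : 1 / 4 * |V x| ≤ ρ x * (2 * ρ x - 3) * V x ^ 2 / (2 * (ρ x - 1)) := by
      rw [le_div_iff₀ (by linarith)]
      linarith
    linarith [neg_abs_le (V x)]
  have h1 := hmono (left_mem_Icc.2 hp.2) (right_mem_Icc.2 hp.2) hp.2
  have h2 := hE (mem_Ici.2 le_rfl) hp.1 hp.1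
  simp only [hy] at h1
  linarith

/-- Beyond a far point at which the solution is close to `±1` there is at most one zero. -/
theorem zeros_subsingleton {X : ℝ} (hX : 3 ≤ ρ X) (hWX : 9 / 10 ≤ |W X|) :
    {x | W x = 0 ∧ X ≤ x}.Subsingleton := by
  wlog hpos : 9 / 10 ≤ W X generalizing W V
  · have hneg : 9 / 10 ≤ -W X := (le_abs.1 hWX).resolve_left hpos
    have := this hs.neg (by rwa [abs_neg]) hneg
    simpa using this
  suffices H : ∀ y z, W y = 0 → X ≤ y → W z = 0 → y < z → False by
    intro y hy z hz
    rcases lt_trichotomy y z with hyz | hyz | hyz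
    · exact (H y z hy.1 hy.2 hz.1 hyz).elim
    · exact hyz
    · exact (H z y hz.1 hz.2 hy.1 hyz).elim
  intro y z hy hXy hz hyz
  have hcont := hs.continuous_fst
  obtain ⟨q, ⟨hq, hqW⟩, hqmin⟩ := (isCompact_Icc (a := X) (b := y)).inter_right
    (isClosed_eq hcont continuous_const) |>.exists_isLeast
    (s := Icc X y ∩ {x | W x = 0}) ⟨y, right_mem_Icc.2 hXy, hy⟩
  have hE := hs.energy_pos_of_first_zero h hX hpos hq.1 hqW fun x hx hx0 =>
    absurd (hqmin ⟨⟨hx.1, hx.2.le.trans hq.2⟩, hx0⟩) (not_le.2 hx.2)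
  obtain ⟨c, hc, hVc⟩ := exists_hasDerivAt_eq_zero hyz hcont.continuousOn (hy.trans hz.symm)
    fun x _ => hs.deriv_fst x
  have hqc : q ≤ c := hq.2.trans hc.1.le
  have h1 := hs.energy_monotoneOn h hX hq.1 (mem_Ici.2 (hq.1.trans hqc)) hqc
  have h2 : energy ρ W V c ≤ 0 := by
    have := well_nonneg (W c)
    simp only [energy, hVc]
    simpa using this
  linarith

/-- A solution with values in `(0, 1]` near infinity tends to `1`. -/
theorem tendsto_one {X : ℝ} (hpos : ∀ x > X, 0 < W x) (hle : ∀ x, W x ≤ 1) :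
    Tendsto W atTop (𝓝 1) := by
  have hVanti : AntitoneOn V (Ioi X) := by
    refine antitoneOn_of_hasDerivWithinAt_nonpos (convex_Ioi X) hs.continuous_snd.continuousOn
      (fun x _ => (hs.deriv_snd x).hasDerivWithinAt) fun x hx => ?_
    rw [interior_Ioi] at hx
    exact mul_nonpos_of_nonneg_of_nonpos (h.potential_pos x).le (force_nonpos (hpos x hx).le)
  -- A concave function that is bounded below near `+∞` is nondecreasing.
  have hV0 : ∀ x > X, 0 ≤ V x := fun x hx => by
    by_contra! hneg
    have hanti : AntitoneOn (fun y => W y - V x * y) (Ici x) := by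
      refine antitoneOn_of_hasDerivWithinAt_nonpos (convex_Ici x)
        (hs.continuous_fst.sub (continuous_const.mul continuous_id)).continuousOn
        (fun y _ => ((hs.deriv_fst y).sub ((hasDerivAt_id y).const_mul (V x))).hasDerivWithinAt)
        fun y hy => ?_
      rw [interior_Ici] at hy
      have := hVanti hx (hx.trans hy) (le_of_lt hy)
      linarith
    have hge : x ≤ x + W x / -V x := by
      have := div_pos (hpos x hx) (neg_pos.2 hneg)
      linarith
    have h1 := hanti (mem_Ici.2 le_rfl) (mem_Ici.2 hge) hge
    have h2 := hpos _ (lt_of_lt_of_le hx hge)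
    have h3 : V x * (x + W x / -V x) = V x * x - W x := by
      have := hneg.ne
      field_simp
      ring
    simp only [h3] at h1
    linarith
  have hWmono : MonotoneOn W (Ioi X) := by
    refine monotoneOn_of_hasDerivWithinAt_nonneg (convex_Ioi X) hs.continuous_fst.continuousOn
      (fun x _ => (hs.deriv_fst x).hasDerivWithinAt) fun x hx => ?_
    rw [interior_Ioi] at hx
    exact hV0 x hx
  refine tendsto_order.2 ⟨fun l hl => ?_, fun u hu => Eventually.of_forall fun x =>
    (hle x).trans_lt hu⟩
  by_contra hnot
  have hbound : ∀ x > X, W x ≤ l := fun x hx => by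
    by_contra! hlt
    refine hnot ?_
    filter_upwards [eventually_ge_atTop x] with y hy
    exact hlt.trans_le (hWmono hx (hx.trans_le hy) hy)
  set x₁ := X + 1 with hx₁
  have hX₁ : X < x₁ := by linarith
  have hw0 := hpos x₁ hX₁
  have hl0 : 0 < l := hw0.trans_le (hbound x₁ hX₁)
  set c := W x₁ * (1 - l ^ 2) with hc
  have hc0 : 0 < c := mul_pos hw0 (by nlinarith)
  have hforce : ∀ y ≥ x₁, force (W y) ≤ -c := fun y hy => by
    have hyX : X < y := hX₁.trans_le hy
    have h1 := hWmono hX₁ hyX hy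
    have h2 := hbound y hyX
    rw [force_of_abs_le (abs_le.2 ⟨by linarith [hpos y hyX], hle y⟩), hc]
    have h4 : 1 - l ^ 2 ≤ 1 - W y ^ 2 := by nlinarith
    have h5 : 0 ≤ 1 - l ^ 2 := by nlinarith
    nlinarith
  -- If `W` stayed below `l < 1`, then `V ≥ c / ρ` by integration from infinity, so that `W` would
  -- grow like `c log ρ`.
  have hVρ : ∀ x ≥ x₁, c * (ρ x)⁻¹ ≤ V x := fun x hx => by
    have hanti : AntitoneOn (fun y => V y + c * -(ρ y)⁻¹) (Ici x₁) := by
      have hd : ∀ y, HasDerivAt (fun y => V y + c * -(ρ y)⁻¹)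
          (scaledPotential ρ y * force (W y) + c * scaledPotential ρ y) y := fun y =>
        (hs.deriv_snd y).fun_add ((h.hasDerivAt_neg_inv y).const_mul c)
      refine antitoneOn_of_hasDerivWithinAt_nonpos (convex_Ici x₁)
        (fun y _ => (hd y).continuousAt.continuousWithinAt)
        (fun y _ => (hd y).hasDerivWithinAt) fun y hy => ?_
      rw [interior_Ici] at hy
      nlinarith [hforce y (le_of_lt hy), h.potential_pos y]
    have hlim : Tendsto (fun y => c * -(ρ y)⁻¹) atTop (𝓝 0) := by
      simpa using (tendsto_inv_atTop_zero.comp h.tendsto_atTop).neg.const_mul c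
    have : 0 ≤ V x + c * -(ρ x)⁻¹ := by
      refine le_of_tendsto hlim ?_
      filter_upwards [eventually_ge_atTop x] with y hy
      have h1 := hanti (mem_Ici.2 hx) (mem_Ici.2 (le_trans hx hy)) hy
      have h2 := hV0 y (hX₁.trans_le (le_trans hx hy))
      simp only at h1
      linarith
    linarith
  have hmono : MonotoneOn (fun y => W y - c * Real.log (ρ y)) (Ici x₁) := by
    have hd : ∀ y, HasDerivAt (fun y => W y - c * Real.log (ρ y))
        (V y - c * ((1 - (ρ y)⁻¹) / ρ y)) y := fun y =>
      (hs.deriv_fst y).fun_sub (((h.hasDerivAt y).log (h.pos y).ne').const_mul c)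
    refine monotoneOn_of_hasDerivWithinAt_nonneg (convex_Ici x₁)
      (fun y _ => (hd y).continuousAt.continuousWithinAt)
      (fun y _ => (hd y).hasDerivWithinAt) fun y hy => ?_
    rw [interior_Ici] at hy
    have h1 := hVρ y (le_of_lt hy)
    have h2 : (1 - (ρ y)⁻¹) / ρ y ≤ (ρ y)⁻¹ := by
      rw [div_eq_mul_inv]
      exact mul_le_of_le_one_left (inv_pos.2 (h.pos y)).le (h.lapse_lt_one y).le
    nlinarith
  have hlog : Tendsto (fun y => c * Real.log (ρ y)) atTop atTop :=
    (Real.tendsto_log_atTop.comp h.tendsto_atTop).const_mul_atTop hc0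
  obtain ⟨y, hy, hyx⟩ := ((hlog.eventually_gt_atTop (1 - (W x₁ - c * Real.log (ρ x₁)))).and
    (eventually_ge_atTop x₁)).exists
  have h1 := hmono (mem_Ici.2 le_rfl) (mem_Ici.2 hyx) hyx
  simp only at h1
  linarith [hle y]

end IsSolution

/-! ### Counting zeros -/

theorem mul_pos_of_forall_ne_zero {f : ℝ → ℝ} (hf : Continuous f) {p q : ℝ} (hpq : p ≤ q)
    (hne : ∀ x ∈ Icc p q, f x ≠ 0) : 0 < f p * f q := by
  have hp := hne p (left_mem_Icc.2 hpq)
  have hq := hne q (right_mem_Icc.2 hpq)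
  rcases lt_or_gt_of_ne hp with hp | hp <;> rcases lt_or_gt_of_ne hq with hq | hq
  · exact mul_pos_of_neg_of_neg hp hq
  · obtain ⟨x, hx, hx0⟩ := intermediate_value_Icc hpq hf.continuousOn ⟨hp.le, hq.le⟩
    exact absurd hx0 (hne x hx)
  · obtain ⟨x, hx, hx0⟩ := intermediate_value_Icc' hpq hf.continuousOn ⟨hq.le, hp.le⟩
    exact absurd hx0 (hne x hx)
  · exact mul_pos hp hq

/-- A function that is positive far to the left and has only simple zeros has sign `(-1)ⁿ` after
`n` zeros. -/
theorem neg_one_pow_mul_pos {f f' : ℝ → ℝ} (hd : ∀ x, HasDerivAt f (f' x) x)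
    (hsimple : ∀ x, f x = 0 → f' x ≠ 0) {x₀ : ℝ} (hpos : ∀ x ≤ x₀, 0 < f x) (n : ℕ) :
    ∀ y, f y ≠ 0 → {x | f x = 0 ∧ x < y}.encard = n → 0 < (-1 : ℝ) ^ n * f y := by
  have hcont : Continuous f := continuous_iff_continuousAt.2 fun x => (hd x).continuousAt
  induction n with
  | zero =>
    intro y hy hn
    have hemp : {x | f x = 0 ∧ x < y} = ∅ := encard_eq_zero.1 (by simpa using hn)
    have h1 := mul_pos_of_forall_ne_zero hcont (min_le_right x₀ y) fun x hx hx0 => by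
      rcases hx.2.eq_or_lt with rfl | hlt
      · exact hy hx0
      · exact (hemp ▸ (⟨hx0, hlt⟩ : x ∈ {x | f x = 0 ∧ x < y}) : x ∈ (∅ : Set ℝ))
    have h2 := hpos _ (min_le_left x₀ y)
    simpa using (pos_iff_pos_of_mul_pos h1).1 h2
  | succ n ih =>
    intro y hy hn
    have hfin : {x | f x = 0 ∧ x < y}.Finite := finite_of_encard_eq_coe hn
    have hne : {x | f x = 0 ∧ x < y}.Nonempty := by
      rw [← encard_ne_zero, hn]
      simp
    obtain ⟨z, ⟨hz0, hzy⟩, hzmax⟩ := exists_max_image _ id hfin hne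
    obtain ⟨ε, hε, hsign⟩ := exists_pos_mul_of_hasDerivAt (hd z) hz0 (hsimple z hz0)
    have hl : 0 < f' z * f (z - ε / 2) * (z - ε / 2 - z) := hsign _ (by linarith) (by
      rw [abs_lt]; constructor <;> linarith)
    have hl0 : f (z - ε / 2) ≠ 0 := fun e => by rw [e] at hl; simp at hl
    have hset : {x | f x = 0 ∧ x < z - ε / 2} = {x | f x = 0 ∧ x < y} \ {z} := by
      ext x
      constructor
      · rintro ⟨hx0, hx⟩
        exact ⟨⟨hx0, by linarith⟩, fun e => by rw [mem_singleton_iff] at e; linarith⟩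
      · rintro ⟨⟨hx0, hx⟩, hxz⟩
        have hxz' : x ≤ z := hzmax x ⟨hx0, hx⟩
        refine ⟨hx0, ?_⟩
        by_contra! hge
        have := hsign x hxz (by rw [abs_lt]; constructor <;> linarith)
        rw [hx0] at this
        simp at this
    have hcard : {x | f x = 0 ∧ x < z - ε / 2}.encard = n := by
      have hz : z ∈ {x | f x = 0 ∧ x < y} := ⟨hz0, hzy⟩
      have hz1 := encard_sdiff_singleton_add_one hz
      rw [hn, Nat.cast_succ] at hz1
      rw [hset]
      exact WithTop.add_right_cancel ENat.one_ne_top hz1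
    have h1 := ih _ hl0 hcard
    set m := min (ε / 2) ((y - z) / 2) with hm
    have hm0 : 0 < m := lt_min (by linarith) (by linarith)
    have hm1 : m ≤ ε / 2 := min_le_left _ _
    have hm2 : m ≤ (y - z) / 2 := min_le_right _ _
    have hr : 0 < f' z * f (z + m) * (z + m - z) := hsign _ (by linarith) (by
      rw [abs_lt]; constructor <;> linarith)
    have h2 := mul_pos_of_forall_ne_zero hcont (by linarith : z + m ≤ y) fun x hx hx0 => by
      rcases hx.2.eq_or_lt with rfl | hlt
      · exact hy hx0
      · have : x ≤ z := hzmax x ⟨hx0, hlt⟩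
        linarith [hx.1]
    have h3 : 0 < f' z * f (z + m) := by
      rw [add_sub_cancel_left] at hr
      exact pos_of_mul_pos_left hr hm0.le
    have h4 : f' z * f (z - ε / 2) < 0 := by nlinarith
    have h5 : f (z - ε / 2) * f y < 0 := by
      have h6 : (f' z * f (z - ε / 2)) * ((f' z * f (z + m)) * (f (z + m) * f y)) < 0 :=
        mul_neg_of_neg_of_pos h4 (mul_pos h3 h2)
      have h7 : (f' z * f (z - ε / 2)) * ((f' z * f (z + m)) * (f (z + m) * f y))
          = (f' z * f (z + m)) ^ 2 * (f (z - ε / 2) * f y) := by ring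
      rw [h7] at h6
      exact neg_of_mul_neg_right h6 (sq_nonneg _)
    rw [pow_succ]
    rcases lt_or_gt_of_ne hy with hy | hy
    · have : 0 < f (z - ε / 2) := by nlinarith
      have : 0 < (-1 : ℝ) ^ n := pos_of_mul_pos_left h1 this.le
      nlinarith
    · have : f (z - ε / 2) < 0 := by nlinarith
      have : (-1 : ℝ) ^ n < 0 := by nlinarith
      nlinarith

theorem encard_biUnion_finset_le {ι α : Type*} (t : Finset ι) (s : ι → Set α) :
    (⋃ i ∈ t, s i).encard ≤ ∑ i ∈ t, (s i).encard := by
  classical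
  induction t using Finset.induction_on with
  | empty => simp
  | insert i t hi ih =>
    rw [Finset.set_biUnion_insert, Finset.sum_insert hi]
    exact (encard_union_le _ _).trans (by gcongr)

theorem IsHorizonFamily.eq_zero {ρ : ℝ → ℝ} {W V : ℝ → ℝ → ℝ} (F : IsHorizonFamily ρ W V) :
    W 0 = fun _ => 0 :=
  (F.unique 0 _ _ (IsSolution.const force_zero) tendsto_const_nhds tendsto_const_nhds).symm

theorem IsAreaRadius.continuous_uncurry_of_abs_sub_le {ρ : ℝ → ℝ} (h : IsAreaRadius ρ)
    {G : ℝ → ℝ → ℝ} (hc : ∀ a, Continuous (G a))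
    (hl : ∀ a b x, |G a x - G b x| ≤ 2 * |a - b| * ρ x ^ 4) :
    Continuous fun q : ℝ × ℝ => G q.1 q.2 := by
  refine continuous_iff_continuousAt.2 fun q₀ => ?_
  have h1 : Tendsto (fun q : ℝ × ℝ => 2 * |q.1 - q₀.1| * ρ q.2 ^ 4) (𝓝 q₀) (𝓝 0) := by
    have : Continuous fun q : ℝ × ℝ => 2 * |q.1 - q₀.1| * ρ q.2 ^ 4 := by
      have := h.continuous
      fun_prop
    simpa using this.tendsto q₀
  have h2 := squeeze_zero_norm (f := fun q : ℝ × ℝ => G q.1 q.2 - G q₀.1 q.2)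
    (fun q => hl q.1 q₀.1 q.2) h1
  have h3 : Tendsto (fun q : ℝ × ℝ => G q₀.1 q.2) (𝓝 q₀) (𝓝 (G q₀.1 q₀.2)) :=
    ((hc q₀.1).comp continuous_snd).tendsto q₀
  simpa [ContinuousAt] using h2.add h3

namespace IsHorizonFamily

variable {ρ : ℝ → ℝ} {W V : ℝ → ℝ → ℝ} (F : IsHorizonFamily ρ W V) (h : IsAreaRadius ρ)
include F h

theorem tendsto_atBot (a : ℝ) : Tendsto (W a) atBot (𝓝 a) := by
  have h1 : Tendsto (fun x => ρ x - 1) atBot (𝓝 0) := by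
    simpa using h.tendsto_atBot.sub_const 1
  have h2 := squeeze_zero_norm (f := fun x => W a x - a) (fun x => F.abs_sub_le a x) h1
  simpa using h2.add_const a

theorem slope_ne_zero {a : ℝ} (ha : a ≠ 0) {p : ℝ} (hp : W a p = 0) : V a p ≠ 0 := fun hV => by
  have hc := (F.isSolution a).eq_const h hV (by rw [hp, force_zero])
  have h1 := F.tendsto_atBot h a
  have h2 : W a = fun _ => 0 := funext fun x => (hc x).trans hp
  rw [h2] at h1
  exact ha (tendsto_nhds_unique h1 tendsto_const_nhds)

theorem continuous_uncurry_fst : Continuous fun q : ℝ × ℝ => W q.1 q.2 :=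
  h.continuous_uncurry_of_abs_sub_le (fun a => (F.isSolution a).continuous_fst) F.lipschitz_fst

theorem continuous_uncurry_snd : Continuous fun q : ℝ × ℝ => V q.1 q.2 :=
  h.continuous_uncurry_of_abs_sub_le (fun a => (F.isSolution a).continuous_snd) F.lipschitz_snd

theorem continuous_param (x : ℝ) : Continuous fun a => W a x :=
  (F.continuous_uncurry_fst h).comp (continuous_id.prodMk continuous_const)

theorem exists_forall_le_pos {a : ℝ} (ha : 0 < a) :
    ∃ x₀, ∀ᶠ b in 𝓝 a, ∀ x ≤ x₀, 0 < W b x := by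
  obtain ⟨x₀, hx₀⟩ := (h.tendsto_atBot.eventually_lt_const
    (by linarith : (1 : ℝ) < 1 + a / 2)).exists
  refine ⟨x₀, ?_⟩
  filter_upwards [lt_mem_nhds (by linarith : a / 2 < a)] with b hb x hx
  have h1 := (abs_le.1 (F.abs_sub_le b x)).1
  have h2 := h.strictMono.monotone hx
  linarith

/-- The number of zeros is lower semicontinuous in the horizon value, as zeros are simple. -/
theorem eventually_le_encard {a : ℝ} (ha : a ≠ 0) {k : ℕ} (hk : k ≤ {x | W a x = 0}.encard) :
    ∀ᶠ b in 𝓝 a, k ≤ {x | W b x = 0}.encard := by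
  obtain ⟨T, hT, hTk⟩ := exists_subset_encard_eq hk
  have hTfin : T.Finite := finite_of_encard_eq_coe hTk
  obtain ⟨U, hU, hdisj⟩ := hTfin.t2_separation
  have hex : ∀ z ∈ T, ∃ p q, p ≤ q ∧ Icc p q ⊆ U z ∧ W a p * W a q < 0 := fun z hz => by
    obtain ⟨ε, hε, hsign⟩ := exists_pos_mul_of_hasDerivAt ((F.isSolution a).deriv_fst z) (hT hz)
      (F.slope_ne_zero h ha (hT hz))
    obtain ⟨δ, hδ, hball⟩ := Metric.isOpen_iff.1 (hU z).2 z (hU z).1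
    set m := min (ε / 2) (δ / 2)
    have hm0 : 0 < m := lt_min (by linarith) (by linarith)
    have hm1 : m ≤ ε / 2 := min_le_left _ _
    have hm2 : m ≤ δ / 2 := min_le_right _ _
    refine ⟨z - m, z + m, by linarith, fun x hx => hball ?_, ?_⟩
    · rw [Metric.mem_ball, Real.dist_eq, abs_lt]
      constructor <;> linarith [hx.1, hx.2]
    · have h1 := hsign (z - m) (by linarith) (by rw [abs_lt]; constructor <;> linarith)
      have h2 := hsign (z + m) (by linarith) (by rw [abs_lt]; constructor <;> linarith)
      have h3 : 0 < V a z * W a (z + m) := by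
        rw [add_sub_cancel_left] at h2
        exact pos_of_mul_pos_left h2 hm0.le
      have h4 : V a z * W a (z - m) < 0 := by nlinarith
      have h5 : V a z ^ 2 * (W a (z - m) * W a (z + m)) < 0 := by nlinarith
      exact neg_of_mul_neg_right h5 (sq_nonneg _)
  choose! p q hpq hsub hneg using hex
  have hev : ∀ᶠ b in 𝓝 a, ∀ z ∈ T, W b (p z) * W b (q z) < 0 := by
    rw [eventually_all_finite hTfin]
    intro z hz
    exact (((F.continuous_param h (p z)).mul (F.continuous_param h (q z))).tendsto
      a).eventually_lt_const (hneg z hz)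
  filter_upwards [hev] with b hb
  have hzero : ∀ z ∈ T, ∃ x ∈ U z, W b x = 0 := fun z hz => by
    by_contra! hne
    exact absurd (mul_pos_of_forall_ne_zero (F.isSolution b).continuous_fst (hpq z hz)
      fun x hx => hne x (hsub z hz hx)) (hb z hz).not_gt
  choose! g hgU hg0 using hzero
  have hinj : InjOn g T := fun z hz z' hz' e => by
    by_contra hzz
    exact disjoint_left.1 (hdisj hz hz' hzz) (hgU z hz) (e ▸ hgU z' hz')
  rw [← hTk, ← hinj.encard_image]
  exact encard_le_encard (image_subset_iff.2 hg0)

/-- Near every point, nearby solutions have at most as many zeros as the given one. -/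
theorem exists_nhds_encard_le {a : ℝ} (ha : a ≠ 0) (x : ℝ) : ∃ U ∈ 𝓝 x, ∀ᶠ b in 𝓝 a,
    ({y | W b y = 0} ∩ U).encard ≤ ({x} ∩ {y | W a y = 0}).encard := by
  by_cases hx : W a x = 0
  · have h1 : ∀ᶠ r : ℝ × ℝ in 𝓝 (a, x), V r.1 r.2 ≠ 0 :=
      (F.continuous_uncurry_snd h).continuousAt.eventually_ne (F.slope_ne_zero h ha hx)
    rw [nhds_prod_eq, eventually_prod_iff] at h1
    obtain ⟨pa, hpa, px, hpx, hV⟩ := h1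
    obtain ⟨ε, hε, hball⟩ := Metric.eventually_nhds_iff_ball.1 hpx
    refine ⟨Metric.ball x ε, Metric.ball_mem_nhds x hε, hpa.mono fun b hb => ?_⟩
    have hx' : x ∈ {y | W a y = 0} := hx
    have hR : ({x} ∩ {y | W a y = 0}).encard = 1 := by
      rw [inter_eq_left.2 (singleton_subset_iff.2 hx'), encard_singleton]
    rw [hR, encard_le_one_iff_subsingleton]
    -- Two zeros in the ball would enclose a critical point.
    suffices H : ∀ y z, W b y = 0 → y ∈ Metric.ball x ε → W b z = 0 → z ∈ Metric.ball x ε →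
        y < z → False by
      intro y hy z hz
      rcases lt_trichotomy y z with hyz | hyz | hyz
      · exact (H y z hy.1 hy.2 hz.1 hz.2 hyz).elim
      · exact hyz
      · exact (H z y hz.1 hz.2 hy.1 hy.2 hyz).elim
    intro y z hy hyb hz hzb hyz
    obtain ⟨c, hc, hVc⟩ := exists_hasDerivAt_eq_zero hyz
      (F.isSolution b).continuous_fst.continuousOn (hy.trans hz.symm)
      fun t _ => (F.isSolution b).deriv_fst t
    exact hV hb (hball c ((convex_ball x ε).ordConnected.out hyb hzb ⟨hc.1.le, hc.2.le⟩)) hVc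
  · have h1 : ∀ᶠ r : ℝ × ℝ in 𝓝 (a, x), W r.1 r.2 ≠ 0 :=
      (F.continuous_uncurry_fst h).continuousAt.eventually_ne hx
    rw [nhds_prod_eq, eventually_prod_iff] at h1
    obtain ⟨pa, hpa, px, hpx, hW⟩ := h1
    refine ⟨{y | px y}, hpx, hpa.mono fun b hb => ?_⟩
    have hemp : {y | W b y = 0} ∩ {y | px y} = ∅ :=
      eq_empty_of_forall_notMem fun y hy => hW hb hy.2 hy.1
    rw [hemp, encard_empty]
    exact zero_le

/-- On a left half-line the number of zeros is upper semicontinuous in the horizon value. -/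
theorem eventually_encard_le {a : ℝ} (ha : 0 < a) (X : ℝ) : ∀ᶠ b in 𝓝 a,
    {x | W b x = 0 ∧ x ≤ X}.encard ≤ {x | W a x = 0 ∧ x ≤ X}.encard := by
  obtain ⟨x₀, hx₀⟩ := F.exists_forall_le_pos h ha
  choose U hU hev using F.exists_nhds_encard_le h ha.ne'
  obtain ⟨t, htK, ht⟩ := (isCompact_Icc (a := x₀) (b := X)).elim_nhds_subcover U fun x _ => hU x
  have hall : ∀ᶠ b in 𝓝 a, ∀ x ∈ t,
      ({y | W b y = 0} ∩ U x).encard ≤ ({x} ∩ {y | W a y = 0}).encard := by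
    rw [Filter.eventually_all_finset]
    exact fun x _ => hev x
  filter_upwards [hx₀, hall] with b hb0 hb
  classical
  calc {x | W b x = 0 ∧ x ≤ X}.encard ≤ (⋃ x ∈ t, {y | W b y = 0} ∩ U x).encard := by
        refine encard_le_encard fun y hy => ?_
        have hy0 : x₀ ≤ y := by
          by_contra! hlt
          exact (hb0 y hlt.le).ne' hy.1
        obtain ⟨x, hxt, hx⟩ := mem_iUnion₂.1 (ht ⟨hy0, hy.2⟩)
        exact mem_iUnion₂.2 ⟨x, hxt, hy.1, hx⟩
    _ ≤ ∑ x ∈ t, ({y | W b y = 0} ∩ U x).encard := encard_biUnion_finset_le _ _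
    _ ≤ ∑ x ∈ t, ({x} ∩ {y | W a y = 0}).encard := Finset.sum_le_sum hb
    _ = ∑ x ∈ t, if W a x = 0 then 1 else 0 := by
        refine Finset.sum_congr rfl fun x _ => ?_
        split_ifs with hx
        · have hx' : x ∈ {y | W a y = 0} := hx
          rw [inter_eq_left.2 (singleton_subset_iff.2 hx'), encard_singleton]
        · have hx' : x ∉ {y | W a y = 0} := hx
          rw [(disjoint_singleton_left.2 hx').inter_eq, encard_empty]
    _ = ((t.filter fun x => W a x = 0 : Finset ℝ) : Set ℝ).encard := by
        rw [Finset.sum_boole, encard_coe_eq_coe_finsetCard]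
    _ ≤ {x | W a x = 0 ∧ x ≤ X}.encard := by
        refine encard_le_encard fun x hx => ?_
        rw [Finset.mem_coe, Finset.mem_filter] at hx
        exact ⟨hx.2, (htK x hx.1).2⟩

/-- A solution that leaves `[-1, 1]` has no zeros afterwards, and neither have its neighbours. -/
theorem eventually_encard_le_of_exit {a : ℝ} (ha : 0 < a) (ha1 : a < 1) {x₁ : ℝ}
    (hx₁ : 1 < |W a x₁|) : ∀ᶠ b in 𝓝 a, {x | W b x = 0}.encard ≤ {x | W a x = 0}.encard := by
  obtain ⟨x₀, hx₀⟩ := ((F.tendsto_atBot h a).eventually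
    (Ioo_mem_nhds (by linarith : (-1 : ℝ) < a) ha1)).and (eventually_le_atBot x₁) |>.exists
  have h1 : ∀ᶠ b in 𝓝 a, W b x₀ ∈ Ioo (-1 : ℝ) 1 :=
    ((F.continuous_param h x₀).tendsto a).eventually (isOpen_Ioo.mem_nhds hx₀.1)
  have h2 : ∀ᶠ b in 𝓝 a, 1 < |W b x₁| :=
    ((F.continuous_param h x₁).abs.tendsto a).eventually_const_lt hx₁
  filter_upwards [h1, h2, F.eventually_encard_le h ha x₁] with b hb0 hb1 hb
  have hsub : {x | W b x = 0} ⊆ {x | W b x = 0 ∧ x ≤ x₁} := fun x hx => by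
    refine ⟨hx, ?_⟩
    have hx' : W b x = 0 := hx
    by_contra! hlt
    rcases lt_abs.1 hb1 with hp | hp
    · have := (F.isSolution b).one_lt_of_one_lt h hb0.2.le hx₀.2 hp hlt.le
      linarith
    · have := (F.isSolution b).neg.one_lt_of_one_lt h (by linarith [hb0.1]) hx₀.2 hp hlt.le
      linarith
  exact (encard_le_encard hsub).trans (hb.trans (encard_le_encard fun x hx => hx.1))

/-- A solution with values in `[-1, 1]` and `n` zeros tends to `(-1)ⁿ`. -/
theorem tendsto_atTop {a : ℝ} (ha : 0 < a) (hle : ∀ x, |W a x| ≤ 1) {n : ℕ}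
    (hn : {x | W a x = 0}.encard = n) : Tendsto (W a) atTop (𝓝 ((-1) ^ n)) := by
  have hs := F.isSolution a
  obtain ⟨X, hX⟩ := (finite_of_encard_eq_coe hn).bddAbove
  have hne : ∀ x > X, W a x ≠ 0 := fun x hx hx0 => (hX hx0).not_gt hx
  obtain ⟨x₀, hx₀⟩ := F.exists_forall_le_pos h ha
  have hsign : ∀ x > X, 0 < (-1 : ℝ) ^ n * W a x := fun x hx => by
    refine neg_one_pow_mul_pos hs.deriv_fst (fun p hp => F.slope_ne_zero h ha.ne' hp)
      hx₀.self_of_nhds n x (hne x hx) ?_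
    rw [← hn]
    congr 1
    exact Set.ext fun y => ⟨fun hy => hy.1, fun hy => ⟨hy, (hX hy).trans_lt hx⟩⟩
  rcases neg_one_pow_eq_or ℝ n with e | e
  · rw [e] at hsign ⊢
    exact hs.tendsto_one h (X := X) (fun x hx => by simpa using hsign x hx)
      fun x => (abs_le.1 (hle x)).2
  · rw [e] at hsign ⊢
    have := hs.neg.tendsto_one h (X := X) (fun x hx => by simpa using hsign x hx)
      fun x => by linarith [(abs_le.1 (hle x)).1]
    simpa using this.neg

/-- Near a solution with values in `[-1, 1]` and `n` zeros, solutions have at most `n + 1` zeros. -/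
theorem eventually_encard_le_succ {a : ℝ} (ha : 0 < a) (hle : ∀ x, |W a x| ≤ 1) {n : ℕ}
    (hn : {x | W a x = 0}.encard = n) : ∀ᶠ b in 𝓝 a, {x | W b x = 0}.encard ≤ n + 1 := by
  have hlim : Tendsto (fun x => |W a x|) atTop (𝓝 1) := by
    simpa using (F.tendsto_atTop h ha hle hn).abs
  obtain ⟨X, hX, hρX⟩ := ((hlim.eventually_const_lt (by norm_num : (9 / 10 : ℝ) < 1)).and
    (h.tendsto_atTop.eventually_ge_atTop 3)).exists
  have h1 : ∀ᶠ b in 𝓝 a, 9 / 10 < |W b X| :=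
    ((F.continuous_param h X).abs.tendsto a).eventually_const_lt hX
  filter_upwards [h1, F.eventually_encard_le h ha X] with b hb1 hb2
  have htail := encard_le_one_iff_subsingleton.2
    ((F.isSolution b).zeros_subsingleton h hρX hb1.le)
  have hsub : {x | W b x = 0} ⊆ {x | W b x = 0 ∧ x ≤ X} ∪ {x | W b x = 0 ∧ X ≤ x} :=
    fun x hx => (le_total x X).imp (fun hxX => ⟨hx, hxX⟩) fun hxX => ⟨hx, hxX⟩
  calc {x | W b x = 0}.encard
      ≤ {x | W b x = 0 ∧ x ≤ X}.encard + {x | W b x = 0 ∧ X ≤ x}.encard :=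
        (encard_le_encard hsub).trans (encard_union_le _ _)
    _ ≤ {x | W a x = 0}.encard + 1 :=
        add_le_add (hb2.trans (encard_le_encard fun x hx => hx.1)) htail
    _ = n + 1 := by rw [hn]

end IsHorizonFamily

/-! ### Oscillation of small solutions -/

/-- The solution `√s sin (½ log s)`, `s = x + c`, of the Euler equation `φ'' + φ / (2 s²) = 0`. -/
noncomputable def eulerSol (c x : ℝ) : ℝ :=
  Real.exp (1 / 2 * Real.log (x + c)) * Real.sin (1 / 2 * Real.log (x + c))

/-- The derivative of `eulerSol`. -/
noncomputable def eulerSlope (c x : ℝ) : ℝ :=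
  Real.exp (1 / 2 * Real.log (x + c)) *
    (Real.sin (1 / 2 * Real.log (x + c)) + Real.cos (1 / 2 * Real.log (x + c))) / (2 * (x + c))

theorem hasDerivAt_half_log {c x : ℝ} (hx : x + c ≠ 0) :
    HasDerivAt (fun y => 1 / 2 * Real.log (y + c)) (1 / (2 * (x + c))) x := by
  refine ((((hasDerivAt_id x).add_const c).log hx).const_mul (1 / 2)).congr_deriv ?_
  simp only [id]
  field_simp

theorem hasDerivAt_eulerSol {c x : ℝ} (hx : x + c ≠ 0) :
    HasDerivAt (eulerSol c) (eulerSlope c x) x := by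
  have h1 := hasDerivAt_half_log hx
  refine (h1.exp.fun_mul h1.sin).congr_deriv ?_
  rw [eulerSlope]
  field_simp

theorem hasDerivAt_eulerSlope {c x : ℝ} (hx : x + c ≠ 0) :
    HasDerivAt (eulerSlope c) (-(eulerSol c x / (2 * (x + c) ^ 2))) x := by
  have h1 := hasDerivAt_half_log hx
  have h2 : 2 * (x + c) ≠ 0 := mul_ne_zero two_ne_zero hx
  refine ((h1.exp.fun_mul (h1.sin.fun_add h1.cos)).fun_div
    (((hasDerivAt_id x).add_const c).const_mul 2) h2).congr_deriv ?_
  rw [eulerSol]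
  simp only [id]
  field_simp
  ring

/-- Sturm comparison with the Euler equation: a far and small solution vanishes between two
consecutive zeros of `eulerSol`. -/
theorem IsSolution.exists_zero {ρ W V : ℝ → ℝ} (hs : IsSolution ρ W V) (h : IsAreaRadius ρ)
    {c θ : ℝ} (hc : c = ρ 0) (hθ : Real.sin θ = 0) (hθ' : Real.cos θ = 1)
    (h0 : 0 ≤ Real.exp (2 * θ) - c) (hρ : 3 ≤ ρ (Real.exp (2 * θ) - c))
    (hW : ∀ x ≤ Real.exp (2 * (θ + Real.pi)) - c, |W x| ≤ 1 / 2) :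
    ∃ x ∈ Icc (Real.exp (2 * θ) - c) (Real.exp (2 * (θ + Real.pi)) - c), W x = 0 := by
  by_contra! hne
  set α := Real.exp (2 * θ) - c with hα
  set β := Real.exp (2 * (θ + Real.pi)) - c with hβ
  have hαβ : α ≤ β :=
    sub_le_sub_right (Real.exp_le_exp.2 (by linarith [Real.pi_pos])) _
  wlog hpos : 0 < W α generalizing W V
  · refine this hs.neg (fun x hx => by rw [abs_neg]; exact hW x hx)
      (fun x hx => neg_ne_zero.2 (hne x hx)) ?_
    exact neg_pos.2 (lt_of_le_of_ne (not_lt.1 hpos) (hne α (left_mem_Icc.2 hαβ)))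
  have hWpos : ∀ x ∈ Icc α β, 0 < W x := fun x hx =>
    (pos_iff_pos_of_mul_pos (mul_pos_of_forall_ne_zero hs.continuous_fst hx.1
      fun y hy => hne y ⟨hy.1, hy.2.trans hx.2⟩)).1 hpos
  have hsα : α + c = Real.exp (2 * θ) := by rw [hα]; ring
  have hsβ : β + c = Real.exp (2 * (θ + Real.pi)) := by rw [hβ]; ring
  have hcpos : 0 < c := hc ▸ h.pos 0
  have hs0 : ∀ x ∈ Icc α β, 0 < x + c := fun x hx => by linarith [hx.1]
  have hanti : AntitoneOn (fun x => V x * eulerSol c x - W x * eulerSlope c x) (Icc α β) := by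
    have hd : ∀ x ∈ Icc α β, HasDerivAt (fun x => V x * eulerSol c x - W x * eulerSlope c x)
        (eulerSol c x * (scaledPotential ρ x * force (W x) + W x / (2 * (x + c) ^ 2))) x :=
      fun x hx => by
        have hx0 := (hs0 x hx).ne'
        refine (((hs.deriv_snd x).fun_mul (hasDerivAt_eulerSol hx0)).fun_sub
          ((hs.deriv_fst x).fun_mul (hasDerivAt_eulerSlope hx0))).congr_deriv ?_
        ring
    refine antitoneOn_of_hasDerivWithinAt_nonpos (convex_Icc α β)
      (fun x hx => (hd x hx).continuousAt.continuousWithinAt)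
      (fun x hx => (hd x (interior_subset hx)).hasDerivWithinAt) fun x hx => ?_
    have hx := interior_subset hx
    have hx0 := hs0 x hx
    have hWx := hWpos x hx
    have hWx' := (abs_le.1 (hW x hx.2)).2
    have hlog1 : 2 * θ ≤ Real.log (x + c) := by
      rw [Real.le_log_iff_exp_le hx0]
      linarith [hx.1]
    have hlog2 : Real.log (x + c) ≤ 2 * (θ + Real.pi) := by
      rw [Real.log_le_iff_le_exp hx0]
      linarith [hx.2]
    have hsin : 0 ≤ Real.sin (1 / 2 * Real.log (x + c)) := by
      have h1 : Real.sin (1 / 2 * Real.log (x + c))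
          = Real.sin (1 / 2 * Real.log (x + c) - θ) := by
        rw [Real.sin_sub, hθ, hθ']
        ring
      rw [h1]
      exact Real.sin_nonneg_of_nonneg_of_le_pi (by linarith) (by linarith)
    refine mul_nonpos_of_nonneg_of_nonpos (mul_nonneg (Real.exp_pos _).le hsin) ?_
    have hρx : ρ x ≤ x + c := by
      rw [hc, add_comm]
      exact h.le_add (h0.trans hx.1)
    have hρ3 : 3 ≤ ρ x := hρ.trans (h.strictMono.monotone hx.1)
    -- The effective potential `P (1 - W²)` exceeds `(2/3) (3/4) / (x + c)²`.
    have hP : 2 / 3 / (x + c) ^ 2 ≤ scaledPotential ρ x := by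
      have h1 : 2 / 3 ≤ 1 - (ρ x)⁻¹ := by
        have := inv_anti₀ three_pos hρ3
        linarith
      exact div_le_div₀ (by linarith) h1 (pow_pos (h.pos x) 2)
        (pow_le_pow_left₀ (h.pos x).le hρx 2)
    rw [force_of_abs_le (abs_le.2 ⟨by linarith, by linarith⟩)]
    have hW2 : 3 / 4 ≤ 1 - W x ^ 2 := by nlinarith
    have h2 : 2 / 3 / (x + c) ^ 2 * (3 / 4) ≤ scaledPotential ρ x * (1 - W x ^ 2) :=
      mul_le_mul hP hW2 (by norm_num) (h.potential_pos x).le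
    have h3 : W x / (2 * (x + c) ^ 2) = 2 / 3 / (x + c) ^ 2 * (3 / 4) * W x := by
      field_simp
      norm_num
    rw [h3]
    nlinarith
  have key := hanti (left_mem_Icc.2 hαβ) (right_mem_Icc.2 hαβ) hαβ
  have hlα : 1 / 2 * Real.log (α + c) = θ := by rw [hsα, Real.log_exp]; ring
  have hlβ : 1 / 2 * Real.log (β + c) = θ + Real.pi := by rw [hsβ, Real.log_exp]; ring
  have hWβ := hWpos β (right_mem_Icc.2 hαβ)
  have hα0 := hs0 α (left_mem_Icc.2 hαβ)
  have hβ0 := hs0 β (right_mem_Icc.2 hαβ)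
  simp only [eulerSol, eulerSlope, hlα, hlβ, Real.sin_add_pi, Real.cos_add_pi, hθ, hθ'] at key
  have h1 : 0 < W α * (Real.exp θ * (0 + 1) / (2 * (α + c))) := by positivity
  have h2 : 0 < W β * (Real.exp (θ + Real.pi) * (0 + 1) / (2 * (β + c))) := by positivity
  have h3 : W β * (Real.exp (θ + Real.pi) * (-0 + -1) / (2 * (β + c)))
      = -(W β * (Real.exp (θ + Real.pi) * (0 + 1) / (2 * (β + c)))) := by ring
  rw [h3] at key
  linarith

/-- Solutions with a small horizon value stay small for a long time, hence have many zeros. -/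
theorem IsHorizonFamily.eventually_le_encard_zero {ρ : ℝ → ℝ} {W V : ℝ → ℝ → ℝ}
    (F : IsHorizonFamily ρ W V) (h : IsAreaRadius ρ) (n : ℕ) :
    ∀ᶠ a in 𝓝 (0 : ℝ), (n : ℕ∞) ≤ {x | W a x = 0}.encard := by
  set c := ρ 0 with hc
  set θ : ℕ → ℝ := fun j => j * (2 * Real.pi) with hθ
  have hθtop : Tendsto (fun j => Real.exp (2 * θ j) - c) atTop atTop := by
    refine tendsto_atTop_add_const_right _ _ (Real.tendsto_exp_atTop.comp ?_)
    exact (tendsto_natCast_atTop_atTop.atTop_mul_const (by positivity)).const_mul_atTop two_pos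
  obtain ⟨J, hJ⟩ := eventually_atTop.1 ((hθtop.eventually_ge_atTop 0).and
    ((h.tendsto_atTop.comp hθtop).eventually_ge_atTop 3))
  set X := Real.exp (2 * (θ (J + n) + Real.pi)) - c with hX
  have hsmall : ∀ᶠ a in 𝓝 (0 : ℝ), 2 * |a - 0| * ρ X ^ 4 < 1 / 2 := by
    have h1 : Continuous fun a : ℝ => 2 * |a - 0| * ρ X ^ 4 := by fun_prop
    exact (h1.tendsto 0).eventually_lt_const (by simp)
  filter_upwards [hsmall] with a ha
  have hWa : ∀ x ≤ X, |W a x| ≤ 1 / 2 := fun x hx => by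
    have h1 := F.lipschitz_fst a 0 x
    rw [F.eq_zero, sub_zero (W a x)] at h1
    have h2 : ρ x ^ 4 ≤ ρ X ^ 4 :=
      pow_le_pow_left₀ (h.pos x).le (h.strictMono.monotone hx) 4
    nlinarith [abs_nonneg (a - 0)]
  have hex : ∀ i : Fin n, ∃ x ∈ Icc (Real.exp (2 * θ (J + i)) - c)
      (Real.exp (2 * (θ (J + i) + Real.pi)) - c), W a x = 0 := fun i => by
    obtain ⟨h0, h3⟩ := hJ (J + i) (Nat.le_add_right _ _)
    refine (F.isSolution a).exists_zero h hc ?_ ?_ h0 h3 fun x hx => hWa x (hx.trans ?_)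
    · have := Real.sin_add_nat_mul_two_pi 0 (J + i)
      simpa [hθ] using this
    · have := Real.cos_add_nat_mul_two_pi 0 (J + i)
      simpa [hθ] using this
    · refine sub_le_sub_right (Real.exp_le_exp.2 ?_) _
      have h1 : ((J + i : ℕ) : ℝ) ≤ (J + n : ℕ) := by
        exact_mod_cast Nat.add_le_add_left i.2.le J
      have := Real.pi_pos
      simp only [hθ]
      nlinarith
  choose z hz hz0 using hex
  have hmono : StrictMono z := fun i j hij => by
    refine (hz i).2.trans_lt (lt_of_lt_of_le ?_ (hz j).1)
    refine sub_lt_sub_right (Real.exp_lt_exp.2 ?_) _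
    have h1 : ((J + i : ℕ) : ℝ) + 1 ≤ (J + j : ℕ) := by
      exact_mod_cast Nat.add_lt_add_left hij J
    have := Real.pi_pos
    simp only [hθ]
    nlinarith
  have h1 : (n : ℕ∞) ≤ (range z).encard := by
    simpa using hmono.injective.encard_range
  exact h1.trans (encard_le_encard (range_subset_iff.2 hz0))

/-! ### The shooting argument -/

/-- `a` is the horizon value of a solution with values in `[-1, 1]` and exactly `n` zeros. -/
structure IsShot (W : ℝ → ℝ → ℝ) (n : ℕ) (a : ℝ) : Prop where
  pos : 0 < a
  lt_one : a < 1
  abs_le : ∀ x, |W a x| ≤ 1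
  encard : {x | W a x = 0}.encard = n

/-- Below the horizon value of a solution with `n` zeros there is one of a solution with `n + 1`
zeros: the supremum of the values below for which there are at least `n + 2` zeros. -/
theorem IsHorizonFamily.exists_isShot_succ {ρ : ℝ → ℝ} {W V : ℝ → ℝ → ℝ}
    (F : IsHorizonFamily ρ W V) (h : IsAreaRadius ρ) {n : ℕ} {a : ℝ} (ha : IsShot W n a) :
    ∃ b < a, IsShot W (n + 1) b := by
  set E := {b | 0 < b ∧ b < a ∧ ((n + 2 : ℕ) : ℕ∞) ≤ {x | W b x = 0}.encard} with hE
  have hbdd : BddAbove E := ⟨a, fun b hb => hb.2.1.le⟩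
  obtain ⟨b₀, hb₀⟩ : E.Nonempty := by
    have h1 : ∀ᶠ b in 𝓝[>] (0 : ℝ), b ∈ E := by
      filter_upwards [self_mem_nhdsWithin, nhdsWithin_le_nhds (gt_mem_nhds ha.pos),
        nhdsWithin_le_nhds (F.eventually_le_encard_zero h (n + 2))] with b hb0 hb1 hb2
      exact ⟨hb0, hb1, hb2⟩
    exact h1.exists
  set s := sSup E with hs
  have hs0 : 0 < s := hb₀.1.trans_le (le_csSup hbdd hb₀)
  have hfreq : ∃ᶠ b in 𝓝 s, b ∈ E :=
    mem_closure_iff_frequently.1 (csSup_mem_closure ⟨b₀, hb₀⟩ hbdd)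
  have hnot : ∀ k : ℕ, k < n + 2 → ¬∀ᶠ b in 𝓝 s, {x | W b x = 0}.encard ≤ k :=
    fun k hk hev => by
      obtain ⟨b, hb, hbk⟩ := (hfreq.and_eventually hev).exists
      have := hb.2.2.trans hbk
      exact absurd (Nat.cast_le.1 this) (not_le.2 hk)
  have hsa : s < a := by
    refine lt_of_le_of_ne (csSup_le ⟨b₀, hb₀⟩ fun b hb => hb.2.1.le) fun e => ?_
    refine hnot (n + 1) (by omega) ?_
    rw [e]
    exact_mod_cast F.eventually_encard_le_succ h ha.pos ha.abs_le ha.encard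
  -- `E` is open, so its supremum does not belong to it.
  have hcard : {x | W s x = 0}.encard < ((n + 2 : ℕ) : ℕ∞) := by
    by_contra! hge
    have hev : ∀ᶠ b in 𝓝 s, b ∈ E := by
      filter_upwards [lt_mem_nhds hs0, gt_mem_nhds hsa,
        F.eventually_le_encard h hs0.ne' hge] with b hb0 hb1 hb2
      exact ⟨hb0, hb1, hb2⟩
    obtain ⟨b, hsb, hb⟩ := (frequently_gt_nhds s).and_eventually hev |>.exists
    exact (le_csSup hbdd hb).not_gt hsb
  obtain ⟨k, hk⟩ := ENat.ne_top_iff_exists.1 hcard.ne_top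
  rw [← hk] at hcard
  have hkn : k < n + 2 := Nat.cast_lt.1 hcard
  have hs1 : s < 1 := hsa.trans ha.lt_one
  have hle : ∀ x, |W s x| ≤ 1 := by
    by_contra! hex
    obtain ⟨x, hx⟩ := hex
    refine hnot k hkn ?_
    rw [hk]
    exact F.eventually_encard_le_of_exit h hs0 hs1 hx
  have hkn' : n + 1 ≤ k := by
    by_contra! hlt
    refine hnot (k + 1) (by omega) ?_
    exact_mod_cast F.eventually_encard_le_succ h hs0 hle hk.symm
  have hkeq : k = n + 1 := by omega
  exact ⟨s, hsa, hs0, hs1, hle, by rw [← hk, hkeq]⟩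

/-! ### The explicit solution with one zero -/

/-- The explicit solution `(c - ρ) / (ρ + 3 (c - 1))` solves the equation because
`2 c² = 6 c - 3`; its only zero is at `ρ = c`. -/
theorem IsHorizonFamily.isShot_one {ρ : ℝ → ℝ} {W V : ℝ → ℝ → ℝ}
    (F : IsHorizonFamily ρ W V) (h : IsAreaRadius ρ) :
    IsShot W 1 ((1 + √3) / (3 * √3 + 5)) := by
  have h3 : √3 ^ 2 = 3 := Real.sq_sqrt (by norm_num)
  have h3' : 0 < √3 := Real.sqrt_pos.2 (by norm_num)
  obtain ⟨c, hc⟩ : ∃ c : ℝ, c = (3 + √3) / 2 := ⟨_, rfl⟩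
  set w : ℝ → ℝ := fun x => (c - ρ x) / (ρ x + 3 * (c - 1)) with hw
  set v : ℝ → ℝ := fun x => -(4 * c - 3) * (1 - (ρ x)⁻¹) / (ρ x + 3 * (c - 1)) ^ 2 with hv
  have hc2 : 2 * c ^ 2 = 6 * c - 3 := by rw [hc]; nlinarith
  have hc1 : 1 < c := by rw [hc]; linarith
  have hden : ∀ x, 0 < ρ x + 3 * (c - 1) := fun x => by linarith [h.pos x]
  have hle : ∀ x, |w x| ≤ 1 := fun x => by
    rw [hw, abs_le]
    simp only
    rw [le_div_iff₀ (hden x), div_le_iff₀ (hden x)]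
    have := h.one_lt x
    constructor <;> linarith
  have hsol : IsSolution ρ w v := by
    refine ⟨fun x => ?_, fun x => ?_⟩
    · refine (((h.hasDerivAt x).const_sub c).fun_div
        ((h.hasDerivAt x).add_const (3 * (c - 1))) (hden x).ne').congr_deriv ?_
      rw [hv]
      ring
    · have hρ := (h.pos x).ne'
      have hd := (hden x).ne'
      have h1 : HasDerivAt (fun y => 1 - (ρ y)⁻¹) (scaledPotential ρ x) x := by
        simpa [sub_eq_add_neg] using (h.hasDerivAt_neg_inv x).const_add 1
      refine ((h1.const_mul (-(4 * c - 3))).fun_div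
        (((h.hasDerivAt x).add_const (3 * (c - 1))).fun_pow 2) (pow_ne_zero 2 hd)).congr_deriv ?_
      rw [force_of_abs_le (hle x), scaledPotential, hw]
      field_simp
      norm_num
      linear_combination (4 * c - 3) * (ρ x - 1) * (ρ x + 3 * (c - 1)) * hc2
  have hval : (c - 1) / (1 + 3 * (c - 1)) = (1 + √3) / (3 * √3 + 5) := by
    rw [hc, div_eq_div_iff (by linarith) (by linarith)]
    ring
  have hlimw : Tendsto w atBot (𝓝 ((1 + √3) / (3 * √3 + 5))) := by
    rw [← hval]
    exact (h.tendsto_atBot.const_sub c).div (h.tendsto_atBot.add_const _) (by linarith)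
  have hlimv : Tendsto v atBot (𝓝 0) := by
    have h1 : Tendsto (fun x => 1 - (ρ x)⁻¹) atBot (𝓝 0) := by
      simpa using (h.tendsto_atBot.inv₀ one_ne_zero).const_sub 1
    have h2 := (h1.const_mul (-(4 * c - 3))).div
      ((h.tendsto_atBot.add_const (3 * (c - 1))).pow 2) (pow_ne_zero 2 (by linarith))
    rwa [mul_zero, zero_div] at h2
  have hweq := F.unique _ w v hsol hlimw hlimv
  refine ⟨by positivity, ?_, fun x => hweq ▸ hle x, ?_⟩
  · rw [div_lt_one (by positivity)]
    linarith
  · rw [← hweq]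
    obtain ⟨x₀, hx₀⟩ := h.exists_eq hc1
    have : {x | w x = 0} = {x₀} := by
      ext x
      change (c - ρ x) / (ρ x + 3 * (c - 1)) = 0 ↔ x = x₀
      rw [div_eq_zero_iff, or_iff_left (hden x).ne', sub_eq_zero, ← hx₀]
      exact ⟨fun e => (h.strictMono.injective e).symm, fun e => by rw [e]⟩
    rw [this, encard_singleton, Nat.cast_one]

/-! ### Return to the tortoise coordinate -/

/-- In units of the horizon radius the inverse of the tortoise coordinate satisfies
`ρ' = 1 - 1/ρ`. -/
theorem IsTortoise.isAreaRadius {m : ℝ} (hm : 0 < m) {xs : ℝ → ℝ} (hxs : IsTortoise m xs) :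
    IsAreaRadius fun y => radius m xs (2 * m * y) / (2 * m) := by
  have hbij := hxs.bijOn hm
  have h2m : 0 < 2 * m := by linarith
  have hmem : ∀ x, 2 * m < radius m xs x := fun x =>
    Function.invFunOn_mem (hbij.surjOn (mem_univ x))
  have hinv : ∀ x, xs (radius m xs x) = x := fun x =>
    Function.invFunOn_eq (hbij.surjOn (mem_univ x))
  have hN : ∀ r, 2 * m < r → 0 < lapse m r := fun r hr => by
    rw [lapse, sub_pos, div_lt_one (by linarith)]
    exact hr
  have hmono : StrictMonoOn xs (Ioi (2 * m)) :=
    strictMonoOn_of_hasDerivWithinAt_pos (convex_Ioi _)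
      (fun r hr => (hxs r hr).continuousAt.continuousWithinAt)
      (fun r hr => (hxs r (interior_subset hr)).hasDerivWithinAt)
      fun r hr => inv_pos.2 (hN r (interior_subset hr))
  have hrmono : StrictMono (radius m xs) := fun x y hxy => by
    by_contra! hle
    have := hmono.monotoneOn (hmem y) (hmem x) hle
    rw [hinv, hinv] at this
    linarith
  have hrange : radius m xs '' univ = Ioi (2 * m) := by
    refine Subset.antisymm (image_subset_iff.2 fun x _ => hmem x) fun r hr => ⟨xs r, mem_univ _, ?_⟩
    exact hbij.injOn (hmem _) hr (hinv _)
  have hcont : Continuous (radius m xs) := by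
    refine continuous_iff_continuousAt.2 fun x => ?_
    refine (hrmono.strictMonoOn univ).continuousAt_of_image_mem_nhds univ_mem ?_
    rw [hrange]
    exact Ioi_mem_nhds (hmem x)
  have hder : ∀ x, HasDerivAt (radius m xs) (lapse m (radius m xs x)) x := fun x => by
    have h1 := HasDerivAt.of_local_left_inverse hcont.continuousAt (hxs _ (hmem x))
      (inv_ne_zero (hN _ (hmem x)).ne') (Eventually.of_forall hinv)
    rwa [inv_inv] at h1
  refine ⟨fun y => (one_lt_div h2m).2 (hmem _), fun y => ?_⟩
  refine (((hder (2 * m * y)).comp y ((hasDerivAt_id y).const_mul (2 * m))).div_const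
    (2 * m)).congr_deriv ?_
  have := (h2m.trans (hmem (2 * m * y))).ne'
  rw [lapse]
  field_simp

theorem contDiff_of_isSolution {ρ W V : ℝ → ℝ} (h : IsAreaRadius ρ) (hs : IsSolution ρ W V)
    (hle : ∀ x, |W x| ≤ 1) : ContDiff ℝ ∞ W := by
  have hsucc : ∀ (f g : ℝ → ℝ) (n : ℕ), (∀ x, HasDerivAt f (g x) x) → ContDiff ℝ n g →
      ContDiff ℝ (n + 1 : ℕ) f := fun f g n hd hg => by
    have hn : ((n + 1 : ℕ) : WithTop ℕ∞) = (n : WithTop ℕ∞) + 1 := by norm_cast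
    rw [hn, contDiff_succ_iff_deriv]
    refine ⟨fun x => (hd x).differentiableAt, fun hn => by simp at hn, ?_⟩
    rwa [funext fun x => (hd x).deriv]
  have key : ∀ n : ℕ, ContDiff ℝ n W ∧ ContDiff ℝ n V := fun n => by
    induction n with
    | zero => exact ⟨contDiff_zero.2 hs.continuous_fst, contDiff_zero.2 hs.continuous_snd⟩
    | succ n ih =>
      refine ⟨hsucc _ _ n hs.deriv_fst ih.2, hsucc _ _ n hs.deriv_snd ?_⟩
      have h1 : (fun x => scaledPotential ρ x * force (W x))
          = fun x => scaledPotential ρ x * (W x * (W x ^ 2 - 1)) :=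
        funext fun x => by rw [force_of_abs_le (hle x)]
      rw [h1]
      exact (h.contDiff_potential.of_le (by exact_mod_cast le_top)).mul
        (ih.1.mul ((ih.1.pow 2).sub contDiff_const))
  exact contDiff_infty.2 fun n => (key n).1

theorem isStationarySolution_comp_div {m : ℝ} (hm : 0 < m) {xs W V : ℝ → ℝ}
    (hs : IsSolution (fun y => radius m xs (2 * m * y) / (2 * m)) W V)
    (hsmooth : ContDiff ℝ ∞ W) (hle : ∀ x, |W x| ≤ 1) :
    IsStationarySolution m xs fun x => W (x / (2 * m)) := by
  have h2m : 2 * m ≠ 0 := by linarith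
  have hd : ∀ x, HasDerivAt (fun x => x / (2 * m)) (1 / (2 * m)) x :=
    fun x => (hasDerivAt_id x).div_const _
  have h1 : deriv (fun x => W (x / (2 * m))) = fun x => V (x / (2 * m)) * (1 / (2 * m)) :=
    funext fun x => ((hs.deriv_fst _).comp x (hd x)).deriv
  refine ⟨?_, fun t x => ?_, fun x => rfl, fun x => deriv_const _ _⟩
  · have h2 : ContDiff ℝ ∞ fun q : ℝ × ℝ => W (q.2 / (2 * m)) :=
      hsmooth.comp (contDiff_snd.div_const _)
    exact_mod_cast contDiff_infty.1 h2 2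
  · have h2 := (((hs.deriv_snd (x / (2 * m))).comp x (hd x)).mul_const (1 / (2 * m))).deriv
    have h3 : iteratedDeriv 2 (fun _ : ℝ => W (x / (2 * m))) t = 0 := by
      simp [iteratedDeriv_const]
    have h4 : iteratedDeriv 2 (fun y => W (y / (2 * m))) x = scaledPotential
        (fun y => radius m xs (2 * m * y) / (2 * m)) (x / (2 * m)) * force (W (x / (2 * m)))
          * (1 / (2 * m)) * (1 / (2 * m)) := by
      rw [iteratedDeriv_succ, iteratedDeriv_one, h1]
      exact h2
    rw [h3, h4, force_of_abs_le (hle _), scaledPotential, potential, lapse,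
      mul_div_cancel₀ x h2m, inv_div]
    -- At `radius = 0`, which does not occur, both sides vanish since division by zero gives zero.
    by_cases hr : radius m xs x = 0
    · simp [hr]
    · field_simp
      ring

end YMSchwarzschild

theorem theorem1p2 (m : ℝ) (hm : 0 < m) (xs : ℝ → ℝ) (hxs : YMSchwarzschild.IsTortoise m xs) :
    ∃ (a : ℕ → ℝ) (W : ℕ → ℝ → ℝ),
      a 1 = (1 + √3) / (3 * √3 + 5) ∧
      (∀ n : ℕ, 1 ≤ n → 0 < a n ∧ a (n + 1) < a n) ∧
      ∀ n : ℕ, 1 ≤ n →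
        ContDiff ℝ ∞ (W n) ∧
        YMSchwarzschild.IsStationarySolution m xs (W n) ∧
        (∀ x : ℝ, -1 ≤ W n x ∧ W n x ≤ 1) ∧
        Tendsto (W n) atBot (𝓝 (a n)) ∧
        Tendsto (W n) atTop (𝓝 ((-1 : ℝ) ^ n)) ∧
        {x : ℝ | W n x = 0}.encard = (n : ℕ∞) := by
  have h := hxs.isAreaRadius hm
  have h2m : 0 < 2 * m := by linarith
  obtain ⟨W, V, F⟩ := h.exists_isHorizonFamily
  choose next hlt hnext using fun (n : ℕ) (a : {a // YMSchwarzschild.IsShot W n a}) =>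
    F.exists_isShot_succ h a.2
  let s : ∀ n : ℕ, {a // YMSchwarzschild.IsShot W (n + 1) a} := fun n =>
    n.rec ⟨_, F.isShot_one h⟩ fun n a => ⟨next (n + 1) a, hnext (n + 1) a⟩
  have hshot : ∀ n, 1 ≤ n → YMSchwarzschild.IsShot W n (s (n - 1)).1 := fun n hn => by
    obtain ⟨k, rfl⟩ := Nat.exists_eq_add_of_le' hn
    exact (s k).2
  refine ⟨fun n => (s (n - 1)).1, fun n x => W (s (n - 1)).1 (x / (2 * m)), rfl, fun n hn => ?_,
    fun n hn => ?_⟩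
  · refine ⟨(hshot n hn).pos, ?_⟩
    obtain ⟨k, rfl⟩ := Nat.exists_eq_add_of_le' hn
    exact hlt (k + 1) (s k)
  · have hs := hshot n hn
    have hsmooth := YMSchwarzschild.contDiff_of_isSolution h (F.isSolution _) hs.abs_le
    refine ⟨hsmooth.comp (contDiff_id.div_const _),
      YMSchwarzschild.isStationarySolution_comp_div hm (F.isSolution _) hsmooth hs.abs_le,
      fun x => abs_le.1 (hs.abs_le _),
      (F.tendsto_atBot h _).comp (tendsto_id.atBot_div_const h2m),
      (F.tendsto_atTop h hs.pos hs.abs_le hs.encard).comp (tendsto_id.atTop_div_const h2m), ?_⟩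
    have himage : {x | W (s (n - 1)).1 (x / (2 * m)) = 0}
        = (fun y => 2 * m * y) '' {y | W (s (n - 1)).1 y = 0} := by
      ext x
      constructor
      · exact fun hx => ⟨x / (2 * m), hx, mul_div_cancel₀ x h2m.ne'⟩
      · rintro ⟨y, hy, rfl⟩
        change W _ (2 * m * y / (2 * m)) = 0
        rwa [mul_div_cancel_left₀ y h2m.ne']
    exact (congrArg encard himage).trans
      (((mul_right_injective₀ h2m.ne').encard_image _).trans hs.encard)
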